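/- **Definitions.** An *arithmetic circuit* over $\mathbb R$ in variables $x_0,\dots,x_{m-1}$ is a finite directed acyclic graph whose input nodes are labelled by variables (each variable labels at least one input node) or by real constants, and whose internal nodes are binary $+$ or $\times$ gates; some nodes are designated as outputs. Its *size* is its number of nodes, and its *depth* is the length of a longest path from an input node to an output node. It has *depth at most $\Delta$ and width at most $w$* if it can be drawn in horizontal levels $0,1,2,\dots$, with the variables on level $0$, every wire leading to a strictly higher level, and the outputs on levels at most $\Delta$, so that for every $\ell$ at most $w$ non-constant nodes lie on level $\ell$ or lie below it and have a wire leading to a level above $\ell$. A *butterfly matrix* of size $2^p$ is a product $B_{2^p}\cdots B_4B_2$, where $B_{2^{j+1}}$ is block diagonal with blocks $\begin{pmatrix}D_1&D_2\\D_3&D_4\end{pmatrix}$, each $D_i$ diagonal of size $2^j$. For $m\le 2^p$, a matrix $W\in\mathbb R^{m\times m}$ is a *kaleidoscope matrix* of width $r$ and expansion $e=2^p/m$ if it is the upper left corner of a product of $r$ matrices $M_1M_2^{\top}$ with $M_1,M_2$ butterfly matrices of size $2^p$; such a representation has $2r\cdot p\cdot 2\cdot 2^{p}$ parameters. A *BaseConv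 layer* of inner dimension $(N',d')$ maps $u\in\mathbb R^{N'\times d'}$ to $(uW+b_1)\odot(h*u+b_2)$, where $h,b_1,b_2\in\mathbb R^{N'\times d'}$, $W\in\mathbb R^{d'\times d'}$ is a kaleidoscope matrix, $\odot$ is the entrywise product, and $*$ is the columnwise convolution of length $N'$, either causal (polynomial product modulo $X^{N'}$) or circular (modulo $X^{N'}-1$). Its number of parameters is $3N'd'$ plus that of $W$. An *$(N,L,d,N',d')$-BaseConv model* ($N\le N'$, $d\le d'$) pads its input $u\in\mathbb R^{N\times d}$ with zeros to an $N'\times d'$ matrix with $u$ in its top left corner, applies $L$ such layers in succession, and outputs the top left $N\times d$ corner of the result. **Theorem.** There are absolute constants $A$ and $c\in\mathbb N$ such that the following holds for all integers $n,d,\Delta\ge 1$ and $s,w\ge 2$. Let $\mathcal C$ be an arithmetic circuit in $nd$ variables with $k\le nd$ outputs, of size at most $s$, depth at most $\Delta$ and width at most $w$ (in the sense above). Then there are $L$, $N'$ and an $(n,L,d,N',d)$-BaseConv model that simulates $\mathcal C$: for every $u\in\mathbb R^{n\times d}$ its output is the $n\times d$ matrix whose row-major form consists of the $k$ outputs of $\mathcal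 C$ on the row-major form of $u$, followed by zeros. Moreover * $L\le A\,\Delta\log w$ (number of layers); * $N'd\le A\,w$ (inner dimension $O(w)$; in particular $N'\le A\,w$); * every weight matrix is given as a kaleidoscope matrix of width and expansion at most $A(1+\log d)^c$; * the total number of parameters of the model is at most $A\,s\,\Delta\,(\log s)^c=\tilde O(s\Delta)$. -/

import Mathlib

/-- Label of the node number `i` of an arithmetic circuit in `m` variables over `ℝ`: an input node
carries a variable or a constant; an internal node is a binary sum or product gate.  The operands
of a gate have smaller numbers, i.e. the nodes of the (acyclic) graph are numbered in a
topological order. -/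
inductive CircuitNode (m i : ℕ) : Type
  | var (x : Fin m)
  | const (c : ℝ)
  | add (a b : Fin i)
  | mul (a b : Fin i)

/-- `a` is an operand of the node. -/
def CircuitNode.HasOperand {m i : ℕ} : CircuitNode m i → ℕ → Prop
  | .var _, _ => False
  | .const _, _ => False
  | .add p q, a => a = p ∨ a = q
  | .mul p q, a => a = p ∨ a = q

/-- An arithmetic circuit over `ℝ` in the `m` variables `x₀, …, x_{m-1}`, all of which label input
nodes, with `k` designated output nodes. Its size is its number of nodes. -/
structure ArithCircuit (m k : ℕ) where
  size : ℕ
  node : (i : Fin size) → CircuitNode m i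
  var_node : ∀ x : Fin m, ∃ i, node i = .var x
  out : Fin k → Fin size

namespace ArithCircuit

variable {m k : ℕ} (C : ArithCircuit m k)

/-- The value computed at a node on the input `x`. -/
def value (x : Fin m → ℝ) (i : Fin C.size) : ℝ :=
  match C.node i with
  | .var y => x y
  | .const c => c
  | .add a b => value x ⟨a, a.2.trans i.2⟩ + value x ⟨b, b.2.trans i.2⟩
  | .mul a b => value x ⟨a, a.2.trans i.2⟩ * value x ⟨b, b.2.trans i.2⟩
termination_by i.val

/-- Length of the longest path from an input node to the node `i`. -/
def nodeDepth (i : Fin C.size) : ℕ :=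
  match C.node i with
  | .var _ => 0
  | .const _ => 0
  | .add a b => max (nodeDepth ⟨a, a.2.trans i.2⟩) (nodeDepth ⟨b, b.2.trans i.2⟩) + 1
  | .mul a b => max (nodeDepth ⟨a, a.2.trans i.2⟩) (nodeDepth ⟨b, b.2.trans i.2⟩) + 1
termination_by i.val

/-- The depth: length of the longest path from an input node to an output node. -/
def depth : ℕ := Finset.univ.sup fun j => C.nodeDepth (C.out j)

/-- There is a wire from node `a` into node `i`. -/
def Wire (a i : Fin C.size) : Prop := (C.node i).HasOperand a

/-- A drawing of the circuit in horizontal levels: the variables are on level `0`, and every wire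
leads to a strictly higher level. -/
structure Drawing where
  level : Fin C.size → ℕ
  level_var : ∀ i x, C.node i = .var x → level i = 0
  level_lt : ∀ a i, C.Wire a i → level a < level i

/-- The signals that a horizontal cut directly after level `l` meets: the nodes on level `l`, and
the nodes on lower levels from which a wire leads to a level above `l`. Constants are available
everywhere and are not counted, and several wires leaving the same node carry the same signal. -/
def Drawing.cut {C : ArithCircuit m k} (D : C.Drawing) (l : ℕ) : Set (Fin C.size) :=
  {v | (∀ c, C.node v ≠ .const c) ∧
    (D.level v = l ∨ D.level v < l ∧ ∃ i, C.Wire v i ∧ l < D.level i)}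

/-- `C` has size at most `s`, depth at most `Δ`, and width at most `w`: it can be drawn, with the
outputs on levels at most `Δ`, so that every horizontal cut meets at most `w` signals. -/
structure HasBounds (s Δ w : ℕ) : Prop where
  size_le : C.size ≤ s
  depth_le : C.depth ≤ Δ
  width_le : ∃ D : C.Drawing, (∀ j, D.level (C.out j) ≤ Δ) ∧ ∀ l, (D.cut l).ncard ≤ w

end ArithCircuit

/-- A butterfly matrix of size `n = 2 ^ p`, given by the nonzero entries of its `p` butterfly
factor matrices `B_2^{(n)}, B_4^{(n)}, …, B_n^{(n)}`. -/
structure Butterfly (p : ℕ) where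
  diag : Fin p → Fin (2 ^ p) → ℝ
  offDiag : Fin p → Fin (2 ^ p) → ℝ

namespace Butterfly

variable {p : ℕ} (B : Butterfly p)

/-- The butterfly factor matrix of size `2 ^ p` with block size `2 ^ (j + 1)`: it is block diagonal
with blocks `[D₁ D₂; D₃ D₄]`, each `Dᵢ` diagonal of size `2 ^ j`. So in row `r` only the columns `r`
and `r ± 2 ^ j` (in the same block), that is `r xor 2 ^ j`, may carry a nonzero entry. -/
def factor (j : Fin p) : Matrix (Fin (2 ^ p)) (Fin (2 ^ p)) ℝ :=
  Matrix.of fun r c =>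
    if c = r then B.diag j r
    else if (c : ℕ) = (r : ℕ) ^^^ 2 ^ (j : ℕ) then B.offDiag j r
    else 0

/-- The product `B_n^{(n)} ⋯ B_4^{(n)} B_2^{(n)}`. -/
noncomputable def toMatrix : Matrix (Fin (2 ^ p)) (Fin (2 ^ p)) ℝ :=
  (List.ofFn B.factor).reverse.prod

end Butterfly

/-- An `m × m` matrix of the kaleidoscope hierarchy: the upper left corner of a product of `width`
matrices from `𝓑𝓑*` of size `2 ^ logSize` (so the expansion is `2 ^ logSize / m`). -/
structure Kaleidoscope (m : ℕ) where
  width : ℕ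
  logSize : ℕ
  le_size : m ≤ 2 ^ logSize
  left : Fin width → Butterfly logSize
  right : Fin width → Butterfly logSize

namespace Kaleidoscope

variable {m : ℕ} (K : Kaleidoscope m)

/-- The product `M_width ⋯ M_2 M_1`, where `M_i` is the `i`-th left butterfly matrix times the
transpose of the `i`-th right one. -/
noncomputable def expanded : Matrix (Fin (2 ^ K.logSize)) (Fin (2 ^ K.logSize)) ℝ :=
  (List.ofFn fun i => (K.left i).toMatrix * (K.right i).toMatrix.transpose).reverse.prod

noncomputable def toMatrix : Matrix (Fin m) (Fin m) ℝ :=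
  K.expanded.submatrix (Fin.castLE K.le_size) (Fin.castLE K.le_size)

/-- The number of parameters: each of the `2 * width` butterfly matrices has `logSize` factors with
`2 * 2 ^ logSize` entries each. -/
def params : ℕ := 2 * K.width * (K.logSize * (2 * 2 ^ K.logSize))

/-- Width and expansion are at most `A * (1 + log m) ^ c`. -/
def IsPolylog (A : ℝ) (c : ℕ) : Prop :=
  (K.width : ℝ) ≤ A * (1 + Real.log m) ^ c ∧
    ((2 ^ K.logSize : ℕ) : ℝ) ≤ A * (1 + Real.log m) ^ c * m

end Kaleidoscope

/-- The two kinds of convolution of vectors of length `N` that a layer may use: polynomial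
multiplication modulo `X ^ N` and modulo `X ^ N - 1`. -/
inductive ConvKind : Type
  | causal
  | circular

/-- Convolution of two matrices, column by column. -/
noncomputable def columnConv {N d : ℕ} (kind : ConvKind) (h u : Matrix (Fin N) (Fin d) ℝ) :
    Matrix (Fin N) (Fin d) ℝ :=
  Matrix.of fun i t =>
    match kind with
    | .causal => ∑ a : Fin N, ∑ b : Fin N,
        if (a : ℕ) + (b : ℕ) = (i : ℕ) then h a t * u b t else 0
    | .circular => ∑ a : Fin N, ∑ b : Fin N,
        if ((a : ℕ) + (b : ℕ)) % N = (i : ℕ) then h a t * u b t else 0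

/-- A BaseConv layer on `N × d` matrices: a kaleidoscope weight matrix, a filter for each column,
and two bias matrices. -/
structure BaseConvLayer (N d : ℕ) where
  weight : Kaleidoscope d
  kind : ConvKind
  filter : Matrix (Fin N) (Fin d) ℝ
  bias₁ : Matrix (Fin N) (Fin d) ℝ
  bias₂ : Matrix (Fin N) (Fin d) ℝ

namespace BaseConvLayer

variable {N d : ℕ} (ℓ : BaseConvLayer N d)

/-- `(u W + b₁) ⊙ (h ∗ u + b₂)`. -/
noncomputable def eval (u : Matrix (Fin N) (Fin d) ℝ) : Matrix (Fin N) (Fin d) ℝ :=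
  Matrix.hadamard (u * ℓ.weight.toMatrix + ℓ.bias₁) (columnConv ℓ.kind ℓ.filter u + ℓ.bias₂)

def params : ℕ := ℓ.weight.params + 3 * (N * d)

end BaseConvLayer

/-- An `(N, L, d, N', d')`-BaseConv model: `L` stacked layers with inner dimension `(N', d')`,
for inputs and outputs in `ℝ^{N × d}`. -/
structure BaseConvModel (N L d N' d' : ℕ) where
  le_rows : N ≤ N'
  le_cols : d ≤ d'
  layer : Fin L → BaseConvLayer N' d'

namespace BaseConvModel

variable {N L d N' d' : ℕ} (M : BaseConvModel N L d N' d')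

/-- The input as the top left corner of an `N' × d'` matrix that is zero elsewhere. -/
def embed (N' d' : ℕ) (u : Matrix (Fin N) (Fin d) ℝ) : Matrix (Fin N') (Fin d') ℝ :=
  Matrix.of fun i t =>
    if h : (i : ℕ) < N ∧ (t : ℕ) < d then u ⟨i, h.1⟩ ⟨t, h.2⟩ else 0

/-- The output: the top left `N × d` corner of the output of the last layer. -/
noncomputable def eval (u : Matrix (Fin N) (Fin d) ℝ) : Matrix (Fin N) (Fin d) ℝ :=
  ((List.ofFn M.layer).foldl (fun z ℓ => ℓ.eval z) (embed N' d' u)).submatrix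
    (Fin.castLE M.le_rows) (Fin.castLE M.le_cols)

def params : ℕ := ∑ i, (M.layer i).params

end BaseConvModel

/-- The row-major form of a matrix. -/
def rowMajor {n d : ℕ} (u : Matrix (Fin n) (Fin d) ℝ) : Fin (n * d) → ℝ :=
  fun i => u i.divNat i.modNat

/-- The `n × d` matrix whose row-major form is `v` followed by zeros. -/
def ofRowMajor (n d : ℕ) {k : ℕ} (v : Fin k → ℝ) : Matrix (Fin n) (Fin d) ℝ :=
  Matrix.of fun i t => if h : (i : ℕ) * d + (t : ℕ) < k then v ⟨i * d + t, h⟩ else 0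

/-! The first columns and rows of the inner matrix serve as a memory of `2 ^ (b + q)` slots in
row-major order, where `2 ^ q ≤ d ≤ 2 ^ (q + 1)`. The circuit is run level by level. A memory with
room for the signals of one cut and all outputs suffices, so its size is proportional to the width.
In one program step every slot independently evaluates a product-plus-sum instruction on slots of
its choice, so a step can compute all gates of a level and move every other live signal to a new
place (`simulates_step`, `Drawing.exists_program`).

The cost lies in the data movement: operands must be fetched along an arbitrary map of `2 ^ p`
indices. By `Routable.all` such a map is a composition of `5 p` maps, each of which inverts at most
one fixed bit of every index. Sorting the indices by their image leaves a monotone map. This factors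
as a monotone 1-Lipschitz rank function, which can be routed bit by bit without collisions, followed
by a permutation; permutations are handled by the Beneš decomposition, which rests on a 2-colouring
(`exists_two_coloring`).

A single-bit move costs two layers (`simulates_flip`). A low bit lies in the column index, and the
permutation matrix inverting it is essentially one butterfly factor. A high bit lies in the row
index, and inverting it shifts the row by a signed power of two, which is a convolution with a
delta. The entrywise product with bias matrices masks and selects (`simulates_shifts`), and the same
product also performs the multiplications of the gates (`simulates_gate`).

Thus a level costs `O(log w)` layers, each with a weight matrix of width `1` and expansion at most
`2`. -/

/-! ### Routing index maps by single-bit inversions. -/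

/-- Two fixed point free involutions of a finite set have a common proper 2-colouring. -/
theorem exists_two_coloring {V : Type*} [Finite V] (a b : Equiv.Perm V)
    (ha : ∀ x, a (a x) = x) (hb : ∀ x, b (b x) = x) (fa : ∀ x, a x ≠ x) (fb : ∀ x, b x ≠ x) :
    ∃ χ : V → Bool, (∀ x, χ (a x) ≠ χ x) ∧ ∀ x, χ (b x) ≠ χ x := by
  have haa : a * a = 1 := Equiv.ext ha
  have hbb : b * b = 1 := Equiv.ext hb
  have hinv : a⁻¹ = a := inv_eq_of_mul_eq_one_right haa
  have hbinv : b⁻¹ = b := inv_eq_of_mul_eq_one_right hbb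
  have hcomm : ∀ k : ℤ, (a * b) ^ (-k) * a = a * (a * b) ^ k := by
    intro k
    have h1 : a * (a * b) * a⁻¹ = (a * b)⁻¹ := by
      rw [mul_inv_rev, hinv, hbinv, ← mul_assoc, haa, one_mul]
    have h2 : a * (a * b) ^ k * a⁻¹ = (a * b) ^ (-k) := by
      rw [← conj_zpow, h1, inv_zpow, zpow_neg]
    rw [← h2, inv_mul_cancel_right]
  -- It suffices to colour the cycles of `a * b`: conjugation by `a` inverts `a * b`, so `a`
  -- permutes these cycles, and `b` acts on them in the same way as `a`.
  let st := Equiv.Perm.SameCycle.setoid (a * b)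
  have hfin : Finite (Quotient st) := inferInstance
  obtain ⟨e, he⟩ := Countable.exists_injective_nat (Quotient st)
  let q : V → Quotient st := fun x => Quotient.mk st x
  have hq : ∀ x y, q x = q y ↔ (a * b).SameCycle x y := fun x y => Quotient.eq
  have hA : ∀ x y, q x = q y → q (a x) = q (a y) := by
    intro x y h
    obtain ⟨k, hk⟩ := (hq x y).1 h
    refine (hq _ _).2 ⟨-k, ?_⟩
    rw [← hk, ← Equiv.Perm.mul_apply, hcomm, Equiv.Perm.mul_apply]
  have hB : ∀ x, q (b x) = q (a x) := fun x => (hq _ _).2 ⟨1, by simp [hb]⟩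
  -- If `(a * b) ^ k` takes `x` to `a x`, then the point half way, `(a * b) ^ m` of `x`, is fixed by
  -- `a` when `k = 2 m` and by `b` when `k = 2 m + 1`.
  have hne : ∀ x, q (a x) ≠ q x := by
    intro x h
    obtain ⟨k, hk⟩ := (hq _ _).1 h.symm
    obtain ⟨m, rfl | rfl⟩ := Int.even_or_odd' k
    · apply fa (((a * b) ^ m) x)
      rw [← Equiv.Perm.mul_apply, ← hcomm, Equiv.Perm.mul_apply, ← hk, ← Equiv.Perm.mul_apply,
        ← zpow_add]
      congr 2; ring
    · apply fb (((a * b) ^ m) x)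
      apply a.injective
      have h1 : a (((a * b) ^ m) x) = ((a * b) ^ (-m)) (a x) := by
        rw [← Equiv.Perm.mul_apply, ← hcomm, Equiv.Perm.mul_apply]
      have h2 : a * b * (a * b) ^ m = (a * b) ^ (-m) * (a * b) ^ (2 * m + 1) := by
        rw [← zpow_one_add, ← zpow_add]
        congr 1; ring
      rw [h1, ← hk]
      exact DFunLike.congr_fun h2 x
  have hqaa : ∀ x, q (a (a x)) = q x := fun x => by rw [ha]
  -- So `a` matches the cycles in pairs, and the codes `e` break the symmetry within a pair.
  refine ⟨fun x => decide (e (q x) < e (q (a x))), fun x => ?_, fun x => ?_⟩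
  · have := he.ne (hne x)
    simp only [hqaa, ne_eq, decide_eq_decide]
    omega
  · have := he.ne (hne x)
    have h2 : q (a (b x)) = q x := by rw [← hqaa x]; exact hA _ _ (hB x)
    simp only [hB, h2, ne_eq, decide_eq_decide]
    omega

/-- Inversion of the bit number `j` of an index. -/
def flipBit {p : ℕ} (j : Fin p) (v : Fin (2 ^ p)) : Fin (2 ^ p) :=
  ⟨v ^^^ 2 ^ (j : ℕ), Nat.xor_lt_two_pow v.2 (Nat.pow_lt_pow_right one_lt_two j.2)⟩

theorem flipBit_flipBit {p : ℕ} (j : Fin p) (v : Fin (2 ^ p)) : flipBit j (flipBit j v) = v := by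
  apply Fin.ext
  simp [flipBit]

theorem testBit_flipBit {p : ℕ} (j : Fin p) (v : Fin (2 ^ p)) (i : ℕ) :
    Nat.testBit (flipBit j v) i = (Nat.testBit v i ^^ decide ((j : ℕ) = i)) := by
  simp [flipBit, Nat.testBit_xor, Nat.testBit_two_pow]

/-- Compositions of `n` maps each of which moves every index by inverting at most one bit, always
the same one. -/
inductive Routable (p : ℕ) : ℕ → (Fin (2 ^ p) → Fin (2 ^ p)) → Prop
  | id : Routable p 0 id
  | step {n : ℕ} {f : Fin (2 ^ p) → Fin (2 ^ p)} (j : Fin p) (g : Fin (2 ^ p) → Fin (2 ^ p))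
      (hg : ∀ v, g v = v ∨ g v = flipBit j v) (hf : Routable p n f) : Routable p (n + 1) (f ∘ g)

namespace Routable

variable {p : ℕ}

theorem comp {m n : ℕ} {f g : Fin (2 ^ p) → Fin (2 ^ p)} (hf : Routable p m f)
    (hg : Routable p n g) : Routable p (m + n) (f ∘ g) := by
  induction hg with
  | id => exact hf
  | step j g hg _ ih => exact ih.step j g hg

theorem single (j : Fin p) (g : Fin (2 ^ p) → Fin (2 ^ p))
    (hg : ∀ v, g v = v ∨ g v = flipBit j v) : Routable p 1 g :=
  Routable.id.step j g hg

/-- The permutation that makes the bit `j` of every index equal to its colour. -/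
def sortBit (j : Fin p) (χ : Fin (2 ^ p) → Bool) (v : Fin (2 ^ p)) : Fin (2 ^ p) :=
  if Nat.testBit v j = χ v then v else flipBit j v

theorem sortBit_eq (j : Fin p) (χ : Fin (2 ^ p) → Bool) (v : Fin (2 ^ p)) :
    sortBit j χ v = v ∨ sortBit j χ v = flipBit j v := by
  unfold sortBit; split_ifs <;> simp

theorem testBit_sortBit (j : Fin p) (χ : Fin (2 ^ p) → Bool) (v : Fin (2 ^ p)) :
    Nat.testBit (sortBit j χ v) j = χ v := by
  unfold sortBit
  split_ifs with h
  · exact h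
  · rw [testBit_flipBit]
    revert h
    cases Nat.testBit v j <;> cases χ v <;> simp

theorem testBit_sortBit_of_ne (j : Fin p) (χ : Fin (2 ^ p) → Bool) (v : Fin (2 ^ p)) {i : ℕ}
    (h : (j : ℕ) ≠ i) : Nat.testBit (sortBit j χ v) i = Nat.testBit v i := by
  rcases sortBit_eq j χ v with e | e <;> rw [e]
  rw [testBit_flipBit]
  simp [h]

/-- The two indices that differ in bit `j` have different colours, so either both already agree with
their colours or they are exchanged. -/
theorem sortBit_involutive (j : Fin p) (χ : Fin (2 ^ p) → Bool)
    (hχ : ∀ v, χ (flipBit j v) ≠ χ v) : Function.Involutive (sortBit j χ) := by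
  intro v
  by_cases h : Nat.testBit v j = χ v
  · simp [sortBit, h]
  · have h1 : sortBit j χ v = flipBit j v := by simp [sortBit, h]
    have h2 : Nat.testBit (flipBit j v) j ≠ χ (flipBit j v) := by
      have := hχ v
      have h3 := testBit_sortBit j χ v
      rw [h1] at h3
      rw [h3]
      exact this.symm
    rw [h1, sortBit, if_neg h2, flipBit_flipBit]

/-- Decomposition of permutations as in a Beneš network. -/
theorem perm_of_testBit_eq (j : ℕ) (hj : j ≤ p) (π : Equiv.Perm (Fin (2 ^ p)))
    (hπ : ∀ v i, j ≤ i → Nat.testBit (π v) i = Nat.testBit v i) : Routable p (2 * j) π := by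
  induction j generalizing π with
  | zero =>
    have : (π : Fin (2 ^ p) → Fin (2 ^ p)) = _root_.id :=
      funext fun v => Fin.ext (Nat.eq_of_testBit_eq fun i => hπ v i (Nat.zero_le _))
    rw [this]
    exact .id
  | succ j ih =>
    let J : Fin p := ⟨j, hj⟩
    let a : Equiv.Perm (Fin (2 ^ p)) := Function.Involutive.toPerm _ (flipBit_flipBit J)
    have ha : ∀ v, a v = flipBit J v := fun v => rfl
    have fa : ∀ v, a v ≠ v := by
      intro v h
      have h1 := testBit_flipBit J v j
      rw [← ha, h] at h1
      revert h1
      cases Nat.testBit v j <;> simp [J]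
    -- The colour chooses a half of the Beneš network. Two sources differing in bit `j` must use
    -- different halves, and so must two sources whose targets differ in bit `j`.
    obtain ⟨χ, h1, h2⟩ := exists_two_coloring a (π⁻¹ * a * π) (flipBit_flipBit J)
      (fun x => by simp [ha, flipBit_flipBit]) fa (fun x h => fa (π x) (by
        have := congrArg π h
        simpa using this))
    have h3 : ∀ v, (χ ∘ ⇑π⁻¹) (flipBit J v) ≠ (χ ∘ ⇑π⁻¹) v := by
      intro v
      have := h2 (π⁻¹ v)
      simpa [ha] using this
    let E := Function.Involutive.toPerm _ (sortBit_involutive J χ h1)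
    let E' := Function.Involutive.toPerm _ (sortBit_involutive J (χ ∘ ⇑π⁻¹) h3)
    have hE : ∀ v, E v = sortBit J χ v := fun _ => rfl
    have hE' : ∀ v, E' v = sortBit J (χ ∘ ⇑π⁻¹) v := fun _ => rfl
    have hEE : ∀ v, E (E v) = v := sortBit_involutive J χ h1
    have hEE' : ∀ v, E' (E' v) = v := sortBit_involutive J _ h3
    -- Between the outer switches `E` and `E'`, bit `j` is the colour on both sides, so the middle
    -- permutation preserves it and the induction hypothesis applies.
    have key : ∀ v i, j ≤ i → Nat.testBit ((E' * π * E) v) i = Nat.testBit v i := by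
      intro v i hi
      rcases hi.eq_or_lt with rfl | hi
      · have e1 : Nat.testBit ((E' * π * E) v) J = Nat.testBit v J := by
          have e2 := testBit_sortBit J χ (E v)
          rw [← hE, hEE] at e2
          rw [e2, Equiv.Perm.mul_apply, Equiv.Perm.mul_apply, hE', testBit_sortBit]
          simp
        exact e1
      · have hne : (J : ℕ) ≠ i := hi.ne
        rw [Equiv.Perm.mul_apply, Equiv.Perm.mul_apply, hE', testBit_sortBit_of_ne _ _ _ hne,
          hπ _ _ hi, hE, testBit_sortBit_of_ne _ _ _ hne]
    have := ((single J _ (sortBit_eq J (χ ∘ ⇑π⁻¹))).comp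
      (ih (Nat.le_of_succ_le hj) _ key)).comp (single J _ (sortBit_eq J χ))
    convert this using 1
    · ring
    · funext v
      simp only [Function.comp_apply, Equiv.Perm.mul_apply, ← hE, hEE]
      exact (hEE' _).symm

theorem perm (π : Equiv.Perm (Fin (2 ^ p))) : Routable p (2 * p) π :=
  perm_of_testBit_eq p le_rfl π fun v i hi => by
    rw [Nat.testBit_lt_two_pow ((π v).2.trans_le (Nat.pow_le_pow_right two_pos hi)),
      Nat.testBit_lt_two_pow (v.2.trans_le (Nat.pow_le_pow_right two_pos hi))]

/-- The index with the low bits of `x` and the high bits of `y`. -/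
def mixBits (j : ℕ) (x y : ℕ) : ℕ := 2 ^ j * (y / 2 ^ j) + x % 2 ^ j

theorem testBit_mixBits (j x y i : ℕ) :
    Nat.testBit (mixBits j x y) i = if i < j then Nat.testBit x i else Nat.testBit y i := by
  unfold mixBits
  rw [Nat.testBit_two_pow_mul_add _ (Nat.mod_lt _ (by positivity))]
  split_ifs with h
  · simp [Nat.testBit_mod_two_pow, h]
  · rw [Nat.testBit_div_two_pow]
    congr 1; omega

/-- The bits of `v` are replaced by those of `g v` from the lowest up, so that stage `j` holds
`mixBits j (g v) v`. The Lipschitz condition ensures that indices colliding at some stage have the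
same image, hence every stage is a function of the previous one. -/
theorem of_lipschitz (g : Fin (2 ^ p) → Fin (2 ^ p))
    (hg : ∀ u v, u ≤ v → (g u : ℕ) ≤ g v ∧ (g v : ℕ) - g u ≤ v - u) : Routable p p g := by
  have hlt : ∀ j (v : Fin (2 ^ p)), mixBits j (g v) v < 2 ^ p := by
    intro j v
    apply Nat.lt_pow_two_of_testBit
    intro i hi
    rw [testBit_mixBits, Nat.testBit_lt_two_pow ((g v).2.trans_le (Nat.pow_le_pow_right two_pos hi)),
      Nat.testBit_lt_two_pow (v.2.trans_le (Nat.pow_le_pow_right two_pos hi))]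
    simp
  let h : ℕ → Fin (2 ^ p) → Fin (2 ^ p) := fun j v => ⟨mixBits j (g v) v, hlt j v⟩
  -- Equal high bits put `u` and `v`, hence their images, at distance less than `2 ^ j`; the images
  -- are also congruent modulo `2 ^ j`.
  have hinj : ∀ j u v, u ≤ v → h j u = h j v → g u = g v ∧ (u : ℕ) / 2 ^ j = v / 2 ^ j := by
    intro j u v huv e
    have e1 : 2 ^ j * ((u : ℕ) / 2 ^ j) + (g u : ℕ) % 2 ^ j =
      2 ^ j * ((v : ℕ) / 2 ^ j) + (g v : ℕ) % 2 ^ j := congrArg Fin.val e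
    have hpos : 0 < 2 ^ j := by positivity
    have e2 : (u : ℕ) / 2 ^ j = v / 2 ^ j := by
      have := congrArg (· / 2 ^ j) e1
      simpa [Nat.mul_add_div hpos, Nat.div_eq_of_lt (Nat.mod_lt _ hpos)] using this
    have e3 : (g u : ℕ) % 2 ^ j = g v % 2 ^ j := by rw [e2] at e1; omega
    refine ⟨?_, e2⟩
    obtain ⟨m1, m2⟩ := hg u v huv
    have d1 := Nat.div_add_mod (u : ℕ) (2 ^ j)
    have d2 := Nat.div_add_mod (v : ℕ) (2 ^ j)
    have d3 := Nat.mod_lt (v : ℕ) hpos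
    rw [e2] at d1
    have huv' : (u : ℕ) ≤ v := huv
    have hsmall : (g v : ℕ) - g u < 2 ^ j := by omega
    have hdvd : 2 ^ j ∣ (g v : ℕ) - g u := (Nat.modEq_iff_dvd' m1).1 e3
    have := Nat.eq_zero_of_dvd_of_lt hdvd hsmall
    exact Fin.ext (by omega)
  have hwd : ∀ j u v, h j u = h j v → h (j + 1) u = h (j + 1) v := by
    have aux : ∀ j u v, u ≤ v → h j u = h j v → h (j + 1) u = h (j + 1) v := by
      intro j u v huv e
      obtain ⟨e1, e2⟩ := hinj j u v huv e
      apply Fin.ext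
      simp only [h, mixBits, e1, pow_succ, ← Nat.div_div_eq_div_mul, e2]
    intro j u v e
    rcases le_total u v with huv | huv
    · exact aux j u v huv e
    · exact (aux j v u huv e.symm).symm
  have hflip : ∀ (j : Fin p) v, h (j + 1) v = h j v ∨ h (j + 1) v = flipBit j (h j v) := by
    intro j v
    by_cases hb : Nat.testBit (g v) j = Nat.testBit v j
    · left
      apply Fin.ext
      apply Nat.eq_of_testBit_eq
      intro i
      simp only [h, testBit_mixBits]
      rcases lt_trichotomy i j with hi | rfl | hi
      · simp [hi, hi.trans (Nat.lt_succ_self _)]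
      · simp [hb]
      · simp [hi.not_gt, (Nat.succ_le_of_lt hi).not_gt]
    · right
      apply Fin.ext
      apply Nat.eq_of_testBit_eq
      intro i
      rw [testBit_flipBit]
      simp only [h, testBit_mixBits]
      rcases lt_trichotomy i j with hi | rfl | hi
      · simp [hi, hi.trans (Nat.lt_succ_self _), hi.ne']
      · revert hb
        cases Nat.testBit (g v) j <;> cases Nat.testBit v j <;> simp
      · simp [hi.not_gt, (Nat.succ_le_of_lt hi).not_gt, hi.ne]
  -- The route is built from its end: `n` moves lead from stage `p - n` to `g`. Off the image of a
  -- stage the move is the identity.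
  have hstep : ∀ n, n ≤ p → ∃ f, Routable p n f ∧ ∀ v, f (h (p - n) v) = g v := by
    intro n
    induction n with
    | zero =>
      intro _
      refine ⟨_root_.id, .id, fun v => Fin.ext ?_⟩
      simp [h, mixBits, Nat.div_eq_of_lt v.2, Nat.mod_eq_of_lt (g v).2]
    | succ n ih =>
      intro hn
      obtain ⟨f, hf, hfg⟩ := ih (by omega)
      let j : Fin p := ⟨p - (n + 1), by omega⟩
      have hj : p - n = (j : ℕ) + 1 := by simp only [j]; omega
      classical
      let s : Fin (2 ^ p) → Fin (2 ^ p) := fun v =>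
        if e : ∃ u, h j u = v then h (j + 1) e.choose else v
      have hs : ∀ v, s (h j v) = h (j + 1) v := by
        intro v
        have e : ∃ u, h j u = h j v := ⟨v, rfl⟩
        simp only [s, dif_pos e]
        exact hwd _ _ _ e.choose_spec
      refine ⟨f ∘ s, hf.step j s fun v => ?_, fun v => ?_⟩
      · by_cases e : ∃ u, h j u = v
        · obtain ⟨u, rfl⟩ := e
          rw [hs]
          exact hflip j u
        · left
          simp only [s, dif_neg e]
      · have : h (p - (n + 1)) v = h j v := rfl
        rw [Function.comp_apply, this, hs, ← hj, hfg]
  obtain ⟨f, hf, hfg⟩ := hstep p le_rfl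
  have : f = g := funext fun v => by
    rw [← hfg v]
    congr 1
    apply Fin.ext
    simp [h, mixBits]; omega
  exact this ▸ hf

/-- Equal fibres give a bijection between the two ranges, which extends to a permutation because the
ambient set is finite. -/
theorem _root_.exists_perm_comp_eq {V : Type*} [Finite V] {W : Type*} (r g : W → V)
    (h : ∀ i j, r i = r j ↔ g i = g j) : ∃ τ : Equiv.Perm V, ∀ i, τ (r i) = g i := by
  classical
  have := Fintype.ofFinite V
  let φ : Set.range r → Set.range g := fun x => ⟨g x.2.choose, _, rfl⟩
  have hφ : ∀ i, φ ⟨r i, i, rfl⟩ = ⟨g i, i, rfl⟩ := fun i =>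
    Subtype.ext ((h _ _).1 (Exists.choose_spec (⟨i, rfl⟩ : r i ∈ Set.range r)))
  have hbij : Function.Bijective φ := by
    constructor
    · rintro ⟨_, i, rfl⟩ ⟨_, j, rfl⟩ e
      rw [hφ, hφ] at e
      exact Subtype.ext ((h i j).2 (congrArg Subtype.val e))
    · rintro ⟨_, i, rfl⟩
      exact ⟨_, hφ i⟩
  let ε : {v // v ∈ Set.range r} ≃ {v // v ∈ Set.range g} := Equiv.ofBijective φ hbij
  refine ⟨ε.extendSubtype, fun i => ?_⟩
  rw [Equiv.extendSubtype_apply_of_mem ε _ (⟨i, rfl⟩ : r i ∈ Set.range r)]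
  exact congrArg Subtype.val (hφ i)

/-- Every map of `2 ^ p` indices is routable in `5 p` steps: permute, copy, permute. -/
theorem all (f : Fin (2 ^ p) → Fin (2 ^ p)) : Routable p (5 * p) f := by
  let σ := Tuple.sort f
  have hmono : Monotone (f ∘ σ) := Tuple.monotone_sort f
  -- The default value `2 ^ p` exceeds all others, which keeps `G` monotone on all of `ℕ`.
  let G : ℕ → ℕ := fun i => if h : i < 2 ^ p then (f (σ ⟨i, h⟩) : ℕ) else 2 ^ p
  have hG : Monotone G := by
    intro i j hij
    simp only [G]
    split_ifs with h1 h2 h2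
    · exact hmono (by exact hij : (⟨i, h1⟩ : Fin (2 ^ p)) ≤ ⟨j, h2⟩)
    · exact (Fin.is_lt _).le
    · omega
    · exact le_rfl
  -- The rank grows by one exactly where `G` changes, so it has the fibres of the monotone `G` and
  -- is 1-Lipschitz. Then `f = τ ∘ r ∘ σ⁻¹`, at a cost of `2 p + p + 2 p` moves.
  let rank : ℕ → ℕ := fun i => Nat.rec 0 (fun i r => r + if G (i + 1) = G i then 0 else 1) i
  have hrank : ∀ i, rank (i + 1) = rank i + if G (i + 1) = G i then 0 else 1 := fun i => rfl
  have hrm : Monotone rank := monotone_nat_of_le_succ fun i => by rw [hrank]; omega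
  have hrl : ∀ i k, rank (i + k) ≤ rank i + k := by
    intro i k
    induction k with
    | zero => exact le_rfl
    | succ k ih =>
      rw [← add_assoc, hrank]
      split_ifs <;> omega
  have hiff : ∀ i k, rank i = rank (i + k) ↔ G i = G (i + k) := by
    intro i k
    induction k with
    | zero => simp
    | succ k ih =>
      have h1 := hrank (i + k)
      have h2 := hrm (Nat.le_add_right i k)
      have h3 := hG (Nat.le_add_right i k)
      have h4 := hG (Nat.le_succ (i + k))
      rw [← add_assoc, h1]
      split_ifs with e
      · rw [e, add_zero]; exact ih
      · simp only [Nat.succ_eq_add_one] at h4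
        constructor <;> intro h5 <;> omega
  have hiff' : ∀ i j, rank i = rank j ↔ G i = G j := by
    intro i j
    rcases le_total i j with h | h
    · obtain ⟨k, rfl⟩ := Nat.exists_eq_add_of_le h
      exact hiff i k
    · obtain ⟨k, rfl⟩ := Nat.exists_eq_add_of_le h
      rw [eq_comm, hiff j k, eq_comm]
  have hr0 : ∀ i, rank i ≤ i := fun i => by simpa [rank] using hrl 0 i
  let r : Fin (2 ^ p) → Fin (2 ^ p) := fun i => ⟨rank i, (hr0 i).trans_lt i.2⟩
  obtain ⟨τ, hτ⟩ := exists_perm_comp_eq r (f ∘ σ) (fun i j => by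
    have := hiff' i j
    simp only [G, i.2, j.2, dif_pos] at this
    simpa [r, Fin.ext_iff] using this)
  have hlip : Routable p p r := of_lipschitz r fun u v huv => by
    have huv' : (u : ℕ) ≤ v := huv
    refine ⟨hrm huv', ?_⟩
    have := hrl u (v - u)
    rw [Nat.add_sub_cancel' huv'] at this
    simp only [r]
    omega
  have := ((perm τ).comp hlip).comp (perm σ⁻¹)
  convert this using 1
  · ring
  · funext v
    simp [hτ]

end Routable

/-! ### Layers built from a bit inversion and delta filters. -/

/-- Used to reduce a butterfly product to its single nontrivial factor. -/
theorem prod_ofFn_eq_single {M : Type*} [Monoid M] {n : ℕ} (f : Fin n → M) (j : Fin n)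
    (h : ∀ i, i ≠ j → f i = 1) : (List.ofFn f).reverse.prod = f j := by
  induction n with
  | zero => exact j.elim0
  | succ n ih =>
    rw [List.ofFn_succ, List.reverse_cons, List.prod_append, List.prod_singleton]
    rcases Fin.eq_zero_or_eq_succ j with rfl | ⟨k, rfl⟩
    · have : (List.ofFn fun i : Fin n => f i.succ).reverse.prod = 1 :=
        List.prod_eq_one fun x hx => by
          rw [List.mem_reverse, List.mem_ofFn] at hx
          obtain ⟨i, rfl⟩ := hx
          exact h _ (Fin.succ_ne_zero i)
      rw [this, one_mul]
    · rw [ih (fun i => f i.succ) k fun i hi => h _ fun e => hi (Fin.succ_injective _ e),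
        h 0 (Fin.succ_ne_zero k).symm, mul_one]

theorem xor_two_pow_ne (x k : ℕ) : x ^^^ 2 ^ k ≠ x := fun h => by
  have := congrArg (Nat.testBit · k) h
  simp [Nat.testBit_xor, Nat.testBit_two_pow_self] at this

/-- The kaleidoscope representation of the upper left corner of `α + β X`, where `X` is the
permutation matrix that inverts the bit `j` of an index. -/
def flipWeight {q d : ℕ} (hd : d ≤ 2 ^ (q + 1)) (j : Fin (q + 1)) (α β : ℝ) : Kaleidoscope d where
  width := 1
  logSize := q + 1
  le_size := hd
  left _ := ⟨fun i _ => if i = j then α else 1, fun i _ => if i = j then β else 0⟩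
  right _ := ⟨fun _ _ => 1, fun _ _ => 0⟩

theorem Butterfly.factor_eq_one {p : ℕ} (B : Butterfly p) (j : Fin p) (h1 : B.diag j = 1)
    (h2 : B.offDiag j = 0) : B.factor j = 1 := by
  ext r c
  simp [Butterfly.factor, h1, h2, Matrix.one_apply, eq_comm]

theorem flipWeight_toMatrix {q d : ℕ} (hd : d ≤ 2 ^ (q + 1)) (j : Fin (q + 1)) (α β : ℝ)
    (r c : Fin d) : (flipWeight hd j α β).toMatrix r c =
      (if r = c then α else 0) + if (r : ℕ) = (c : ℕ) ^^^ 2 ^ (j : ℕ) then β else 0 := by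
  have h1 : ((flipWeight hd j α β).left (0 : Fin 1)).toMatrix = ((flipWeight hd j α β).left (0 : Fin 1)).factor j :=
    prod_ofFn_eq_single _ j fun i hi =>
      Butterfly.factor_eq_one _ _ (by ext; simp [flipWeight, hi]) (by ext; simp [flipWeight, hi])
  have h2 : ((flipWeight hd j α β).right (0 : Fin 1)).toMatrix = 1 :=
    List.prod_eq_one fun x hx => by
      rw [List.mem_reverse, List.mem_ofFn] at hx
      obtain ⟨i, rfl⟩ := hx
      exact Butterfly.factor_eq_one _ _ rfl rfl
  have h3 : (flipWeight hd j α β).expanded = ((flipWeight hd j α β).left (0 : Fin 1)).factor j := by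
    unfold Kaleidoscope.expanded
    refine (prod_ofFn_eq_single (n := 1) _ 0 fun i hi => absurd (Subsingleton.elim i 0) hi).trans ?_
    rw [h1, h2, Matrix.transpose_one, mul_one]
  rw [Kaleidoscope.toMatrix, h3]
  have h4 : ((r : ℕ) = (c : ℕ) ^^^ 2 ^ (j : ℕ)) ↔ (c : ℕ) = (r : ℕ) ^^^ 2 ^ (j : ℕ) := by
    constructor <;> intro h <;> rw [h, Nat.xor_assoc, Nat.xor_self, Nat.xor_zero]
  have h5 : (r = c) ↔ Fin.castLE hd c = Fin.castLE hd r := by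
    rw [Fin.ext_iff, Fin.ext_iff, eq_comm]; rfl
  simp only [h4, h5]
  change (if Fin.castLE hd c = Fin.castLE hd r then if j = j then α else 1
    else if (c : ℕ) = (r : ℕ) ^^^ 2 ^ (j : ℕ) then if j = j then β else 0 else 0) = _
  by_cases e : Fin.castLE hd c = Fin.castLE hd r
  · have : (c : ℕ) = r := Fin.val_eq_of_eq (h5.2 e).symm
    simp [e, this, (xor_two_pow_ne _ _).symm]
  · simp [e]

/-- The upper left corner of an infinite matrix. -/
def matOf {N d : ℕ} (f : ℕ → ℕ → ℝ) : Matrix (Fin N) (Fin d) ℝ := Matrix.of fun i c => f i c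

theorem matOf_congr {N d : ℕ} {f g : ℕ → ℕ → ℝ} (h : ∀ i c, i < N → c < d → f i c = g i c) :
    (matOf f : Matrix (Fin N) (Fin d) ℝ) = matOf g := by
  ext i c
  exact h _ _ i.2 c.2

/-- The layer whose weight matrix is `α + β X` with `X` the inversion of the bit `j`, and whose
filter sums the rows at the given offsets. -/
def flipLayer {q d : ℕ} (N : ℕ) (hd : d ≤ 2 ^ (q + 1)) (j : Fin (q + 1)) (α β : ℝ)
    (offs : List ℕ) (b₁ b₂ : ℕ → ℕ → ℝ) : BaseConvLayer N d where
  weight := flipWeight hd j α β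
  kind := .circular
  filter := Matrix.of fun a _ => (offs.map fun o => if ((a : ℕ) + o) % N = 0 then 1 else 0).sum
  bias₁ := matOf b₁
  bias₂ := matOf b₂

/-- The filter is a delta at `-o` modulo `N`, so the circular convolution reads row `i + o`. -/
theorem sum_delta_conv {N : ℕ} (u : ℕ → ℝ) (o : ℕ) (i : Fin N) :
    (∑ a : Fin N, ∑ b : Fin N, if ((a : ℕ) + (b : ℕ)) % N = (i : ℕ) then
      (if ((a : ℕ) + o) % N = 0 then (1 : ℝ) else 0) * u b else 0) = u ((i + o) % N) := by
  have hN : 0 < N := i.pos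
  let a₀ : Fin N := ⟨(N - o % N) % N, Nat.mod_lt _ hN⟩
  let b₀ : Fin N := ⟨(i + o) % N, Nat.mod_lt _ hN⟩
  have h0 : ∀ a : Fin N, ((a : ℕ) + o) % N = 0 ↔ a = a₀ := by
    have h : ((a₀ : ℕ) + o) % N = 0 := by
      have h1 : ((N - o % N) % N + o) % N = ((N - o % N) + o % N) % N := by simp [Nat.add_mod]
      rw [show ((a₀ : ℕ) + o) % N = ((N - o % N) % N + o) % N from rfl, h1,
        Nat.sub_add_cancel (Nat.mod_lt _ hN).le, Nat.mod_self]
    intro a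
    refine ⟨fun e => Fin.ext ?_, fun e => e ▸ h⟩
    have : (a : ℕ) ≡ a₀ [MOD N] := Nat.ModEq.add_right_cancel' o (e.trans h.symm)
    exact this.eq_of_lt_of_lt a.2 a₀.2
  have ha₀ : (a₀ : ℕ) + o ≡ 0 [MOD N] := (h0 a₀).2 rfl
  have h1 : ∀ b : Fin N, ((a₀ : ℕ) + (b : ℕ)) % N = i ↔ b = b₀ := by
    intro b
    have hi : (i : ℕ) % N = i := Nat.mod_eq_of_lt i.2
    constructor
    · intro e
      apply Fin.ext
      have e' : (a₀ : ℕ) + b ≡ i [MOD N] := e.trans hi.symm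
      have e1 : (i : ℕ) + o ≡ b [MOD N] := by
        calc (i : ℕ) + o ≡ a₀ + b + o [MOD N] := (e'.add_right o).symm
          _ = a₀ + o + b := by ring
          _ ≡ 0 + b [MOD N] := ha₀.add_right _
          _ = b := by ring
      exact (Nat.mod_eq_of_lt b.2).symm.trans e1.symm
    · rintro rfl
      have e1 : (a₀ : ℕ) + b₀ ≡ i [MOD N] := by
        calc (a₀ : ℕ) + b₀ ≡ a₀ + (i + o) [MOD N] := (Nat.mod_modEq _ _).add_left _
          _ = a₀ + o + i := by ring
          _ ≡ 0 + i [MOD N] := ha₀.add_right _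
          _ = i := by ring
      exact Eq.trans e1 hi
  rw [Finset.sum_eq_single a₀, Finset.sum_eq_single b₀]
  · rw [if_pos ((h1 _).2 rfl), if_pos ((h0 _).2 rfl), one_mul]
  · intro b _ hb
    rw [if_neg (fun e => hb ((h1 b).1 e))]
  · simp
  · intro a _ ha
    refine Finset.sum_eq_zero fun b _ => ?_
    rw [if_neg (fun e => ha ((h0 a).1 e)), zero_mul, ite_self]
  · simp

theorem columnConv_flipLayer {q d N : ℕ} (hd : d ≤ 2 ^ (q + 1)) (j : Fin (q + 1)) (α β : ℝ)
    (offs : List ℕ) (b₁ b₂ f : ℕ → ℕ → ℝ) (i : Fin N) (c : Fin d) :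
    columnConv .circular (flipLayer N hd j α β offs b₁ b₂).filter (matOf f) i c =
      (offs.map fun o => f ((i + o) % N) c).sum := by
  simp only [columnConv, flipLayer, matOf, Matrix.of_apply]
  induction offs with
  | nil => simp
  | cons o offs ih =>
    simp only [List.map_cons, List.sum_cons]
    rw [← ih, ← sum_delta_conv (fun b => f b c) o i, ← Finset.sum_add_distrib]
    refine Finset.sum_congr rfl fun a _ => ?_
    rw [← Finset.sum_add_distrib]
    refine Finset.sum_congr rfl fun b _ => ?_
    split_ifs <;> ring

/-- The effect of `flipLayer` on infinite matrices. -/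
def flipLayerFun (N j : ℕ) (α β : ℝ) (offs : List ℕ) (b₁ b₂ f : ℕ → ℕ → ℝ) (i c : ℕ) : ℝ :=
  (α * f i c + β * f i (c ^^^ 2 ^ j) + b₁ i c) * ((offs.map fun o => f ((i + o) % N) c).sum + b₂ i c)

/-- The hypothesis `hf` covers the case that inverting the bit leads to a column beyond `d`, which
the truncated weight matrix cannot read. -/
theorem flipLayer_eval {q d N : ℕ} (hd : d ≤ 2 ^ (q + 1)) (j : Fin (q + 1)) (α β : ℝ)
    (offs : List ℕ) (b₁ b₂ f : ℕ → ℕ → ℝ) (hf : β = 0 ∨ ∀ i c, d ≤ c → f i c = 0) :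
    (flipLayer N hd j α β offs b₁ b₂).eval (matOf f) =
      matOf (flipLayerFun N j α β offs b₁ b₂ f) := by
  ext i c
  have h1 : ((matOf f : Matrix (Fin N) (Fin d) ℝ) * (flipLayer N hd j α β offs b₁ b₂).weight.toMatrix) i c =
      α * f i c + β * f i (c ^^^ 2 ^ (j : ℕ)) := by
    simp only [Matrix.mul_apply, flipLayer, flipWeight_toMatrix, mul_add, Finset.sum_add_distrib,
      matOf, Matrix.of_apply]
    congr 1
    · simp [mul_comm]
    · by_cases h : (c : ℕ) ^^^ 2 ^ (j : ℕ) < d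
      · rw [Finset.sum_eq_single ⟨_, h⟩]
        · simp [mul_comm]
        · intro b _ hb
          rw [if_neg (fun e => hb (Fin.ext e)), mul_zero]
        · simp
      · rw [Finset.sum_eq_zero]
        · rcases hf with hf | hf
          · rw [hf, zero_mul]
          · rw [hf _ _ (not_lt.1 h), mul_zero]
        · intro b _
          rw [if_neg (fun e => h (by rw [← e]; exact b.2)), mul_zero]
  have h2 := columnConv_flipLayer (N := N) hd j α β offs b₁ b₂ f i c
  simp only [BaseConvLayer.eval, Matrix.hadamard_apply, Matrix.add_apply]
  rw [h1]
  exact congrArg₂ _ rfl (congrArg₂ _ h2 rfl)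

/-! ### Simulation by stacked layers. -/

/-- The map `T` is computed, between encodings by matrices, by `L` layers with weights of width `1`
and size `2 ^ (q + 1)`. -/
def Simulates (q : ℕ) {N d : ℕ} {X Y : Type*} (L : ℕ) (e : X → Matrix (Fin N) (Fin d) ℝ)
    (e' : Y → Matrix (Fin N) (Fin d) ℝ) (T : X → Y) : Prop :=
  ∃ ls : List (BaseConvLayer N d), ls.length = L ∧
    (∀ ℓ ∈ ls, ℓ.weight.width = 1 ∧ ℓ.weight.logSize = q + 1) ∧
    ∀ x, ls.foldl (fun z ℓ => ℓ.eval z) (e x) = e' (T x)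

namespace Simulates

variable {q N d : ℕ} {X Y Z : Type*}

theorem id (e : X → Matrix (Fin N) (Fin d) ℝ) : Simulates q 0 e e _root_.id :=
  ⟨[], rfl, by simp, fun _ => rfl⟩

theorem comp {L L' : ℕ} {e : X → Matrix (Fin N) (Fin d) ℝ} {e' : Y → Matrix (Fin N) (Fin d) ℝ}
    {e'' : Z → Matrix (Fin N) (Fin d) ℝ} {S : X → Y} {T : Y → Z} (hS : Simulates q L e e' S)
    (hT : Simulates q L' e' e'' T) : Simulates q (L + L') e e'' (T ∘ S) := by
  obtain ⟨l, h1, h2, h3⟩ := hS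
  obtain ⟨l', h1', h2', h3'⟩ := hT
  refine ⟨l ++ l', by simp [h1, h1'], fun ℓ hℓ => ?_, fun x => ?_⟩
  · rcases List.mem_append.1 hℓ with h | h
    · exact h2 _ h
    · exact h2' _ h
  · rw [List.foldl_append, h3, h3']; rfl

end Simulates

theorem mod_of_lt_two_mul {x N : ℕ} (h : x < 2 * N) : x % N = if x < N then x else x - N := by
  split_ifs with h1
  · exact Nat.mod_eq_of_lt h1
  · rw [Nat.mod_eq_sub_mod (not_lt.1 h1), Nat.mod_eq_of_lt (by omega)]

/-- Two layers add up a masked column operation, a masked shift of the rows by `s` and a masked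
shift by `-s`. -/
theorem simulates_shifts {q d : ℕ} (hd : d ≤ 2 ^ (q + 1)) {R s : ℕ} (hs : s ≤ R) (j : Fin (q + 1))
    (α β : ℝ) (b m₁ m₂ : ℕ → ℕ → ℝ) {X Y : Type*} (f : X → ℕ → ℕ → ℝ) (g : Y → ℕ → ℕ → ℝ)
    (T : X → Y) (hf : ∀ x i c, R ≤ i ∨ d ≤ c → f x i c = 0)
    (hg : ∀ x i c, i < 8 * R → c < d → g (T x) i c = if i < R then
      b i c * (α * f x i c + β * f x i (c ^^^ 2 ^ (j : ℕ))) +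
        (if s ≤ i then m₁ (i - s) c * f x (i - s) c else 0) + m₂ (i + s) c * f x (i + s) c
      else 0) :
    Simulates q (N := 8 * R) (d := d) 2 (fun x => matOf (f x)) (fun y => matOf (g y)) T := by
  -- The data occupy the first of eight blocks of `R` rows. The first layer puts the masked column
  -- operation in block 0 and copies masked by `m₁` and `m₂` in blocks 2 and 4; a mask is always the
  -- factor multiplied with the only nonzero data term.
  let b₁ : ℕ → ℕ → ℝ := fun i c => if 2 * R ≤ i ∧ i < 3 * R then m₁ (i - 2 * R) c else
    if 4 * R ≤ i ∧ i < 5 * R then m₂ (i - 4 * R) c else 0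
  let b₂ : ℕ → ℕ → ℝ := fun i c => if i < R then b i c else 0
  let b₃ : ℕ → ℕ → ℝ := fun i _ => if i < R then 1 else 0
  refine ⟨[flipLayer _ hd j α β [6 * R, 4 * R] b₁ b₂,
    -- The second layer adds up the three blocks, displaced by `∓s`, and erases everything below
    -- block 0. As `s ≤ R`, rows displaced past the border fall into the empty blocks 1 and 5.
    flipLayer _ hd j 0 0 [0, 2 * R - s, 4 * R + s] b₃ 0], rfl, by simp [flipLayer, flipWeight],
    fun x => ?_⟩
  simp only [List.foldl_cons, List.foldl_nil]
  rw [flipLayer_eval _ _ _ _ _ _ _ _ (Or.inr fun i c h => hf x i c (Or.inr h)),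
    flipLayer_eval _ _ _ _ _ _ _ _ (Or.inl rfl)]
  refine matOf_congr fun i c hi hc => ?_
  rw [hg x i c hi hc]
  have key : ∀ i, i < 8 * R → flipLayerFun (8 * R) j α β [6 * R, 4 * R] b₁ b₂ (f x) i c =
      if i < R then b i c * (α * f x i c + β * f x i (c ^^^ 2 ^ (j : ℕ))) else
      if 2 * R ≤ i ∧ i < 3 * R then m₁ (i - 2 * R) c * f x (i - 2 * R) c else
      if 4 * R ≤ i ∧ i < 5 * R then m₂ (i - 4 * R) c * f x (i - 4 * R) c else 0 := by
    intro i hi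
    simp only [flipLayerFun, List.map_cons, List.map_nil, List.sum_cons, List.sum_nil]
    rw [mod_of_lt_two_mul (by omega : i + 6 * R < 2 * (8 * R)),
      mod_of_lt_two_mul (by omega : i + 4 * R < 2 * (8 * R))]
    by_cases h1 : i < R
    · have e1 : f x (if i + 6 * R < 8 * R then i + 6 * R else i + 6 * R - 8 * R) c = 0 :=
        hf _ _ _ (Or.inl (by split_ifs <;> omega))
      have e2 : f x (if i + 4 * R < 8 * R then i + 4 * R else i + 4 * R - 8 * R) c = 0 :=
        hf _ _ _ (Or.inl (by split_ifs <;> omega))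
      have e3 : b₁ i c = 0 := by simp only [b₁]; rw [if_neg (by omega), if_neg (by omega)]
      simp only [e1, e2, e3, b₂, if_pos h1]
      ring
    · have e0 : ∀ c, f x i c = 0 := fun c => hf _ _ _ (Or.inl (by omega))
      have e3 : b₂ i c = 0 := if_neg h1
      simp only [e0, e3, if_neg h1, b₁]
      by_cases h2 : 2 * R ≤ i ∧ i < 3 * R
      · have e2 : f x (if i + 4 * R < 8 * R then i + 4 * R else i + 4 * R - 8 * R) c = 0 :=
          hf _ _ _ (Or.inl (by split_ifs <;> omega))
        have e1 : (if i + 6 * R < 8 * R then i + 6 * R else i + 6 * R - 8 * R) = i - 2 * R := by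
          split_ifs <;> omega
        simp only [e1, e2, if_pos h2]
        ring
      · by_cases h3 : 4 * R ≤ i ∧ i < 5 * R
        · have e1 : f x (if i + 6 * R < 8 * R then i + 6 * R else i + 6 * R - 8 * R) c = 0 :=
            hf _ _ _ (Or.inl (by split_ifs <;> omega))
          have e2 : (if i + 4 * R < 8 * R then i + 4 * R else i + 4 * R - 8 * R) = i - 4 * R := by
            split_ifs <;> omega
          simp only [e1, e2, if_neg h2, if_pos h3]
          ring
        · simp only [if_neg h2, if_neg h3]
          ring
  conv_lhs => rw [flipLayerFun]
  simp only [List.map_cons, List.map_nil, List.sum_cons, List.sum_nil, b₃, Pi.zero_apply]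
  by_cases h1 : i < R
  · rw [Nat.add_zero i, Nat.mod_eq_of_lt (by omega : i < 8 * R),
      Nat.mod_eq_of_lt (by omega : i + (2 * R - s) < 8 * R),
      Nat.mod_eq_of_lt (by omega : i + (4 * R + s) < 8 * R),
      key i hi, key (i + (2 * R - s)) (by omega), key (i + (4 * R + s)) (by omega)]
    simp only [if_pos h1]
    rw [if_neg (by omega : ¬ i + (2 * R - s) < R), if_neg (by omega : ¬ i + (4 * R + s) < R),
      if_neg (by omega : ¬ (2 * R ≤ i + (4 * R + s) ∧ i + (4 * R + s) < 3 * R)),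
      if_neg (by omega : ¬ (4 * R ≤ i + (2 * R - s) ∧ i + (2 * R - s) < 5 * R))]
    have t2 : (if 4 * R ≤ i + (4 * R + s) ∧ i + (4 * R + s) < 5 * R then
        m₂ (i + (4 * R + s) - 4 * R) c * f x (i + (4 * R + s) - 4 * R) c else 0) =
        m₂ (i + s) c * f x (i + s) c := by
      rw [show i + (4 * R + s) - 4 * R = i + s by omega]
      split_ifs with h
      · rfl
      · rw [hf x (i + s) c (Or.inl (by omega)), mul_zero]
    have t1 : (if 2 * R ≤ i + (2 * R - s) ∧ i + (2 * R - s) < 3 * R then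
        m₁ (i + (2 * R - s) - 2 * R) c * f x (i + (2 * R - s) - 2 * R) c else 0) =
        if s ≤ i then m₁ (i - s) c * f x (i - s) c else 0 := by
      rw [show i + (2 * R - s) - 2 * R = i - s by omega]
      by_cases h : s ≤ i
      · rw [if_pos h, if_pos (by omega)]
      · rw [if_neg h, if_neg (by omega)]
    rw [t1, t2]
    ring
  · simp only [if_neg h1]
    ring

/-! ### Memory slots and their routing. -/

theorem mul_two_pow_add_lt {a q i c : ℕ} (hi : i < 2 ^ a) (hc : c < 2 ^ q) :
    i * 2 ^ q + c < 2 ^ (a + q) := by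
  calc i * 2 ^ q + c < i * 2 ^ q + 2 ^ q := by omega
    _ = (i + 1) * 2 ^ q := by ring
    _ ≤ 2 ^ a * 2 ^ q := Nat.mul_le_mul_right _ hi
    _ = 2 ^ (a + q) := (pow_add _ _ _).symm

/-- Turns the inversion of a row bit into a shift that a convolution can perform. -/
theorem xor_two_pow_eq (x k : ℕ) :
    x ^^^ 2 ^ k = x + 2 ^ k ∨ 2 ^ k ≤ x ∧ x ^^^ 2 ^ k = x - 2 ^ k := by
  have key : ∀ y, Nat.testBit y k = false → y ^^^ 2 ^ k = y + 2 ^ k := by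
    intro y hy
    have hlow : y % 2 ^ k < 2 ^ k := Nat.mod_lt _ (by positivity)
    have hdiv : y / 2 ^ k % 2 = 0 := by
      rw [Nat.testBit_eq_decide_div_mod_eq] at hy
      simp only [decide_eq_false_iff_not] at hy
      omega
    have e : y + 2 ^ k = 2 ^ k * (y / 2 ^ k + 1) + y % 2 ^ k := by
      have := Nat.div_add_mod y (2 ^ k)
      rw [mul_add]; omega
    apply Nat.eq_of_testBit_eq
    intro i
    rw [e, Nat.testBit_two_pow_mul_add _ hlow, Nat.testBit_xor, Nat.testBit_two_pow,
      Nat.testBit_mod_two_pow]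
    split_ifs with h
    · simp [h, h.ne']
    · obtain ⟨m, rfl⟩ := Nat.exists_eq_add_of_le (not_lt.1 h)
      rw [Nat.add_sub_cancel_left, add_comm k m, Nat.testBit_add]
      cases m with
      | zero =>
        simp only [Nat.testBit_zero, zero_add, decide_true, hdiv]
        rw [show (y / 2 ^ k + 1) % 2 = 1 by omega]; rfl
      | succ m =>
        rw [Nat.testBit_add_one, Nat.testBit_add_one,
          show (y / 2 ^ k + 1) / 2 = y / 2 ^ k / 2 by omega]
        simp
  cases h : Nat.testBit x k with
  | false => exact Or.inl (key x h)
  | true =>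
    right
    have h1 : Nat.testBit (x ^^^ 2 ^ k) k = false := by simp [h]
    have h2 := key _ h1
    rw [Nat.xor_assoc, Nat.xor_self, Nat.xor_zero] at h2
    omega

theorem xor_two_pow_of_lt {q c : ℕ} (hc : c < 2 ^ q) : c ^^^ 2 ^ q = c + 2 ^ q := by
  rcases xor_two_pow_eq c q with h | ⟨h, -⟩
  · exact h
  · omega

theorem mul_two_pow_add_xor_low {q i c j : ℕ} (hc : c < 2 ^ q) (hj : j < q) :
    (i * 2 ^ q + c) ^^^ 2 ^ j = i * 2 ^ q + (c ^^^ 2 ^ j) := by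
  have hc' : c ^^^ 2 ^ j < 2 ^ q := Nat.xor_lt_two_pow hc (Nat.pow_lt_pow_right one_lt_two hj)
  apply Nat.eq_of_testBit_eq
  intro k
  rw [mul_comm i, Nat.testBit_xor, Nat.testBit_two_pow_mul_add _ hc,
    Nat.testBit_two_pow_mul_add _ hc', Nat.testBit_two_pow]
  split_ifs with h
  · simp [Nat.testBit_two_pow]
  · have : j ≠ k := by omega
    simp [this]

theorem mul_two_pow_add_xor_high {q i c j : ℕ} (hc : c < 2 ^ q) :
    (i * 2 ^ q + c) ^^^ 2 ^ (q + j) = (i ^^^ 2 ^ j) * 2 ^ q + c := by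
  apply Nat.eq_of_testBit_eq
  intro k
  rw [mul_comm i, mul_comm (i ^^^ 2 ^ j), Nat.testBit_xor, Nat.testBit_two_pow_mul_add _ hc,
    Nat.testBit_two_pow_mul_add _ hc, Nat.testBit_two_pow]
  split_ifs with h
  · have : q + j ≠ k := by omega
    simp [this]
  · rw [Nat.testBit_xor, Nat.testBit_two_pow]
    congr 1
    simp only [decide_eq_decide]
    omega

/-- The matrix whose top left `2 ^ a × 2 ^ q` corner lists `x` in row-major form. -/
def slotFun {a q : ℕ} (x : Fin (2 ^ (a + q)) → ℝ) (i c : ℕ) : ℝ :=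
  if h : i < 2 ^ a ∧ c < 2 ^ q then x ⟨i * 2 ^ q + c, mul_two_pow_add_lt h.1 h.2⟩ else 0

theorem slotFun_of_lt {a q : ℕ} (x : Fin (2 ^ (a + q)) → ℝ) {i c : ℕ} (hi : i < 2 ^ a)
    (hc : c < 2 ^ q) : slotFun x i c = x ⟨i * 2 ^ q + c, mul_two_pow_add_lt hi hc⟩ :=
  dif_pos ⟨hi, hc⟩

theorem slotFun_eq_zero {a q : ℕ} (x : Fin (2 ^ (a + q)) → ℝ) {i c : ℕ}
    (h : 2 ^ a ≤ i ∨ 2 ^ q ≤ c) : slotFun x i c = 0 :=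
  dif_neg (by omega)

section Routing

variable {a q d : ℕ}

/-- Bits below `q` belong to the column index and are inverted by the weight matrix; the others
belong to the row index and are inverted by row shifts. The masks select, for each slot, the one
term that `g` prescribes. -/
theorem simulates_flip (hd : d ≤ 2 ^ (q + 1)) (hq : 2 ^ q ≤ d) (j : Fin (a + q))
    (g : Fin (2 ^ (a + q)) → Fin (2 ^ (a + q))) (hg : ∀ v, g v = v ∨ g v = flipBit j v) :
    Simulates q (N := 8 * 2 ^ a) (d := d) 2 (fun x => matOf (slotFun x))
      (fun x => matOf (slotFun x)) (fun x => x ∘ g) := by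
  classical
  let G : ℕ → ℕ := fun v => if h : v < 2 ^ (a + q) then g ⟨v, h⟩ else 0
  have hG : ∀ v (h : v < 2 ^ (a + q)), G v = g ⟨v, h⟩ := fun v h => dif_pos h
  have hf : ∀ (x : Fin (2 ^ (a + q)) → ℝ) i c, 2 ^ a ≤ i ∨ d ≤ c → slotFun x i c = 0 :=
    fun x i c h => slotFun_eq_zero x (by omega)
  have hval : ∀ (x : Fin (2 ^ (a + q)) → ℝ) i c (hi : i < 2 ^ a) (hc : c < 2 ^ q) i' c'
      (_ : i' < 2 ^ a) (_ : c' < 2 ^ q), G (i * 2 ^ q + c) = i' * 2 ^ q + c' →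
      slotFun (x ∘ g) i c = slotFun x i' c' := by
    intro x i c hi hc i' c' hi' hc' h
    rw [slotFun_of_lt _ hi hc, slotFun_of_lt _ hi' hc', Function.comp_apply]
    congr 1
    exact Fin.ext ((hG _ _).symm.trans h)
  rcases lt_or_ge (j : ℕ) q with hj | hj
  -- The shift by `0` supplies the slots that stay in place.
  · refine simulates_shifts hd (s := 0) (Nat.zero_le _) ⟨j, by omega⟩ 0 1
      (fun i c => if G (i * 2 ^ q + c) = i * 2 ^ q + c then 0 else 1)
      (fun i c => if G (i * 2 ^ q + c) = i * 2 ^ q + c then 1 else 0) 0 _ _ _ hf ?_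
    intro x i c _ _
    by_cases hi : i < 2 ^ a
    swap
    · rw [if_neg hi, slotFun_eq_zero _ (Or.inl (not_lt.1 hi))]
    simp only [if_pos hi, Nat.sub_zero, Nat.zero_le, if_true, Pi.zero_apply, zero_mul, add_zero,
      zero_add, one_mul]
    by_cases hc : c < 2 ^ q
    · by_cases h0 : G (i * 2 ^ q + c) = i * 2 ^ q + c
      · rw [hval x i c hi hc i c hi hc h0]
        simp [h0]
      · have hc' : c ^^^ 2 ^ (j : ℕ) < 2 ^ q :=
          Nat.xor_lt_two_pow hc (Nat.pow_lt_pow_right one_lt_two hj)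
        rw [hval x i c hi hc i _ hi hc' ?_]
        · simp [h0]
        · have hv := mul_two_pow_add_lt hi hc
          rw [hG _ hv] at h0 ⊢
          rcases hg ⟨_, hv⟩ with e | e
          · exact absurd (congrArg Fin.val e) h0
          · rw [e, ← mul_two_pow_add_xor_low hc hj]; rfl
    · have hc' : 2 ^ q ≤ c ^^^ 2 ^ (j : ℕ) := by
        by_contra h
        have := Nat.xor_lt_two_pow (not_le.1 h) (Nat.pow_lt_pow_right one_lt_two hj)
        rw [Nat.xor_assoc, Nat.xor_self, Nat.xor_zero] at this
        exact hc this
      rw [slotFun_eq_zero _ (Or.inr (not_lt.1 hc)), slotFun_eq_zero x (Or.inr hc'),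
        slotFun_eq_zero x (Or.inr (not_lt.1 hc))]
      simp
  · obtain ⟨k, hk⟩ := Nat.exists_eq_add_of_le hj
    have hk' : 2 ^ k < 2 ^ a := Nat.pow_lt_pow_right one_lt_two (by have := j.2; omega)
    have hkpos : 0 < 2 ^ k := by positivity
    have hqpos : 0 < 2 ^ q := by positivity
    -- The last two masks are indexed by the source row `i`: they ask whether the slot `2 ^ k` rows
    -- below, respectively above, reads from row `i`.
    refine simulates_shifts hd (s := 2 ^ k) hk'.le 0 1 0
      (fun i c => if G (i * 2 ^ q + c) = i * 2 ^ q + c then 1 else 0)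
      (fun i c => if G ((i + 2 ^ k) * 2 ^ q + c) = i * 2 ^ q + c then 1 else 0)
      (fun i c => if 2 ^ k ≤ i ∧ G ((i - 2 ^ k) * 2 ^ q + c) = i * 2 ^ q + c then 1 else 0)
      _ _ _ hf ?_
    intro x i c _ _
    by_cases hi : i < 2 ^ a
    swap
    · rw [if_neg hi, slotFun_eq_zero _ (Or.inl (not_lt.1 hi))]
    rw [if_pos hi]
    by_cases hc : c < 2 ^ q
    swap
    · simp only [slotFun_eq_zero _ (Or.inr (not_lt.1 hc) : _ ∨ 2 ^ q ≤ c)]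
      simp
    have hsub : 2 ^ k ≤ i → i - 2 ^ k + 2 ^ k = i := Nat.sub_add_cancel
    have hadd : i + 2 ^ k - 2 ^ k = i := Nat.add_sub_cancel _ _
    have hcases : G (i * 2 ^ q + c) = i * 2 ^ q + c ∨
        G (i * 2 ^ q + c) = (i + 2 ^ k) * 2 ^ q + c ∧ i + 2 ^ k < 2 ^ a ∨
        2 ^ k ≤ i ∧ G (i * 2 ^ q + c) = (i - 2 ^ k) * 2 ^ q + c := by
      have hv := mul_two_pow_add_lt hi hc
      rw [hG _ hv]
      rcases hg ⟨_, hv⟩ with e | e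
      · left; rw [e]
      · right
        have e' : (g ⟨_, hv⟩ : ℕ) = (i ^^^ 2 ^ k) * 2 ^ q + c := by
          rw [e, ← mul_two_pow_add_xor_high hc, ← hk]; rfl
        rcases xor_two_pow_eq i k with h | ⟨h1, h⟩
        · left
          rw [h] at e'
          refine ⟨e', ?_⟩
          rw [← h]
          exact Nat.xor_lt_two_pow hi hk'
        · right
          rw [h] at e'
          exact ⟨h1, e'⟩
    have hinj : ∀ i', G (i * 2 ^ q + c) = i' * 2 ^ q + c → ∀ i'',
        (G (i * 2 ^ q + c) = i'' * 2 ^ q + c ↔ i' = i'') := by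
      intro i' h i''
      rw [h]
      refine ⟨fun h' => ?_, fun h' => by rw [h']⟩
      exact Nat.eq_of_mul_eq_mul_right hqpos (by omega)
    rcases hcases with h | ⟨h, h2⟩ | ⟨h2, h⟩
    · rw [hval x i c hi hc i c hi hc h]
      simp only [hadd, hinj _ h]
      by_cases hki : 2 ^ k ≤ i
      · have t2 : ¬ i = i - 2 ^ k := by omega
        simp [hki, hsub hki, hinj _ h, t2]
      · simp [hki]
    · rw [hval x i c hi hc (i + 2 ^ k) c h2 hc h]
      simp only [hadd, hinj _ h]
      by_cases hki : 2 ^ k ≤ i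
      · have t2 : ¬ i + 2 ^ k = i - 2 ^ k := by omega
        simp [hki, hsub hki, hinj _ h, t2]
      · simp [hki]
    · rw [hval x i c hi hc (i - 2 ^ k) c (by omega) hc h]
      have t1 : ¬ i - 2 ^ k = i + 2 ^ k := by omega
      have t2 : ¬ i - 2 ^ k = i := by omega
      simp [h2, hsub h2, hadd, hinj _ h, t1, t2]

theorem Routable.simulates (hd : d ≤ 2 ^ (q + 1)) (hq : 2 ^ q ≤ d) {n : ℕ}
    {f : Fin (2 ^ (a + q)) → Fin (2 ^ (a + q))} (hf : Routable (a + q) n f) :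
    Simulates q (N := 8 * 2 ^ a) (d := d) (2 * n) (fun x => matOf (slotFun x))
      (fun x => matOf (slotFun x)) (fun x => x ∘ f) := by
  induction hf with
  | id => exact Simulates.id _
  | step j g hg _ ih => exact ih.comp (simulates_flip hd hq j g hg)

end Routing

/-! ### Executing instructions by layers. -/

/-- The instruction `(y + β) (z + β') + (t + γ)`, where a missing operand `y`, `z`, `t` is `0`. -/
structure Instr (K : ℕ) where
  y : Option (Fin K)
  z : Option (Fin K)
  t : Option (Fin K)
  β : ℝ
  β' : ℝ
  γ : ℝ

/-- The contents of an optional slot. -/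
def readSlot {K : ℕ} (x : Fin K → ℝ) (o : Option (Fin K)) : ℝ := o.elim 0 x

def Instr.eval {K : ℕ} (I : Instr K) (x : Fin K → ℝ) : ℝ :=
  (readSlot x I.y + I.β) * (readSlot x I.z + I.β') + (readSlot x I.t + I.γ)

theorem four_mul_two_pow (b q : ℕ) : 2 ^ (b + 2 + q) = 4 * 2 ^ (b + q) := by
  rw [pow_add, pow_add, pow_add]; ring

section Machine

variable {b q d : ℕ}

/-- Extension of a vector by zeros to the fourfold length. -/
def padSlots (y : Fin (2 ^ (b + q)) → ℝ) (v : Fin (2 ^ (b + 2 + q))) : ℝ :=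
  if h : (v : ℕ) < 2 ^ (b + q) then y ⟨v, h⟩ else 0

/-- Passing to the fourfold memory therefore needs no layer. -/
theorem slotFun_padSlots (y : Fin (2 ^ (b + q)) → ℝ) : slotFun (padSlots y) = slotFun y := by
  funext i c
  have h4 : 2 ^ (b + 2) = 4 * 2 ^ b := by rw [pow_add]; ring
  by_cases hc : c < 2 ^ q
  swap
  · rw [slotFun_eq_zero _ (Or.inr (not_lt.1 hc)), slotFun_eq_zero _ (Or.inr (not_lt.1 hc))]
  by_cases hi : i < 2 ^ b
  · rw [slotFun_of_lt _ hi hc, slotFun_of_lt _ (by omega) hc, padSlots,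
      dif_pos (mul_two_pow_add_lt hi hc)]
  rw [slotFun_eq_zero y (Or.inl (not_lt.1 hi))]
  by_cases hi' : i < 2 ^ (b + 2)
  · rw [slotFun_of_lt _ hi' hc, padSlots, dif_neg]
    have : 2 ^ b * 2 ^ q ≤ i * 2 ^ q := Nat.mul_le_mul_right _ (not_lt.1 hi)
    have hbq : 2 ^ (b + q) = 2 ^ b * 2 ^ q := pow_add _ _ _
    simp only [not_lt]
    omega
  · rw [slotFun_eq_zero _ (Or.inl (not_lt.1 hi'))]

/-- The first and second quarters of the rows hold the factors, the last quarter the summand. One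
layer multiplies each row by the row one quarter further on; behind the last quarter the matrix is
empty, so with bias `1` the summand survives unchanged. The second layer adds it to the product. -/
theorem simulates_gate (hd : d ≤ 2 ^ (q + 1))
    (P : Fin (2 ^ (b + q)) → Instr (2 ^ (b + q))) (x₀ x₁ x₃ : (Fin (2 ^ (b + 2 + q)) → ℝ) →
      Fin (2 ^ (b + q)) → ℝ)
    (h₀ : ∀ x v, x₀ x v = x ⟨v, by have := four_mul_two_pow b q; have := v.2; omega⟩)
    (h₁ : ∀ x v, x₁ x v =
      x ⟨v + 2 ^ (b + q), by have := four_mul_two_pow b q; have := v.2; omega⟩)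
    (h₃ : ∀ x v, x₃ x v =
      x ⟨v + 3 * 2 ^ (b + q), by have := four_mul_two_pow b q; have := v.2; omega⟩) :
    Simulates q (N := 8 * 2 ^ (b + 2)) (d := d) 2 (fun x => matOf (slotFun x))
      (fun y => matOf (slotFun y))
      (fun x v => (x₀ x v + (P v).β) * (x₁ x v + (P v).β') + (x₃ x v + (P v).γ)) := by
  have h4 : 2 ^ (b + 2) = 4 * 2 ^ b := by rw [pow_add]; ring
  have hbq : 2 ^ (b + q) = 2 ^ b * 2 ^ q := pow_add _ _ _
  let F := 2 ^ b
  have hF : 2 ^ b = F := rfl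
  let B : (Instr (2 ^ (b + q)) → ℝ) → ℕ → ℕ → ℝ := fun π => slotFun fun v => π (P v)
  let b₁ : ℕ → ℕ → ℝ := fun i c => if i < F then B Instr.β i c else
    if 3 * F ≤ i then B Instr.γ (i - 3 * F) c else 0
  let b₂ : ℕ → ℕ → ℝ := fun i c => if i < F then B Instr.β' i c else 1
  let b₃ : ℕ → ℕ → ℝ := fun i _ => if i < F then 1 else 0
  refine ⟨[flipLayer _ hd 0 1 0 [F] b₁ b₂, flipLayer _ hd 0 0 0 [0, 3 * F] b₃ 0], rfl,
    by simp [flipLayer, flipWeight], fun x => ?_⟩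
  simp only [List.foldl_cons, List.foldl_nil]
  rw [flipLayer_eval _ _ _ _ _ _ _ _ (Or.inl rfl), flipLayer_eval _ _ _ _ _ _ _ _ (Or.inl rfl)]
  refine matOf_congr fun i c hi hc => ?_
  conv_lhs => rw [flipLayerFun]
  simp only [List.map_cons, List.map_nil, List.sum_cons, List.sum_nil, b₃, Pi.zero_apply, zero_mul,
    zero_add, add_zero]
  by_cases hi : i < F
  swap
  · rw [if_neg hi, zero_mul, slotFun_eq_zero _ (Or.inl (not_lt.1 hi))]
  rw [if_pos hi, one_mul, Nat.mod_eq_of_lt (by omega : i < _),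
    Nat.mod_eq_of_lt (by omega : i + 3 * F < _)]
  simp only [flipLayerFun, List.map_cons, List.map_nil, List.sum_cons, List.sum_nil, one_mul,
    zero_mul, add_zero]
  rw [Nat.mod_eq_of_lt (by omega : i + F < _), Nat.mod_eq_of_lt (by omega : i + 3 * F + F < _)]
  simp only [b₁, b₂, if_pos hi, if_neg (by omega : ¬ i + 3 * F < F),
    if_pos (by omega : 3 * F ≤ i + 3 * F), Nat.add_sub_cancel]
  rw [slotFun_eq_zero x (Or.inl (by omega) : 2 ^ (b + 2) ≤ i + 3 * F + F ∨ 2 ^ q ≤ c), zero_add,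
    mul_one]
  by_cases hc' : c < 2 ^ q
  swap
  · have hc'' : 2 ^ q ≤ c := not_lt.1 hc'
    simp only [B, slotFun_eq_zero _ (Or.inr hc'' : _ ∨ 2 ^ q ≤ c)]
    simp
  simp only [B]
  rw [slotFun_of_lt _ hi hc', slotFun_of_lt _ hi hc', slotFun_of_lt _ hi hc',
    slotFun_of_lt _ hi hc', slotFun_of_lt x (by omega) hc', slotFun_of_lt x (by omega) hc',
    slotFun_of_lt x (by omega) hc', h₀, h₁, h₃]
  have e1 : (⟨(i + F) * 2 ^ q + c, mul_two_pow_add_lt (by omega) hc'⟩ : Fin (2 ^ (b + 2 + q))) =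
      ⟨i * 2 ^ q + c + 2 ^ (b + q), by
        have := mul_two_pow_add_lt hi hc'; have := four_mul_two_pow b q; omega⟩ :=
    Fin.ext (by simp only [hbq]; ring)
  have e3 : (⟨(i + 3 * F) * 2 ^ q + c, mul_two_pow_add_lt (by omega) hc'⟩ :
      Fin (2 ^ (b + 2 + q))) = ⟨i * 2 ^ q + c + 3 * 2 ^ (b + q), by
        have := mul_two_pow_add_lt hi hc'; have := four_mul_two_pow b q; omega⟩ :=
    Fin.ext (by simp only [hbq]; ring)
  rw [e1, e3]

/-- A program step, in which every slot receives the value of its own instruction. -/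
theorem simulates_step (hd : d ≤ 2 ^ (q + 1)) (hq : 2 ^ q ≤ d)
    (P : Fin (2 ^ (b + q)) → Instr (2 ^ (b + q))) :
    Simulates q (N := 8 * 2 ^ (b + 2)) (d := d) (2 * (5 * (b + 2 + q)) + 2)
      (fun y => matOf (slotFun y)) (fun y => matOf (slotFun y))
      (fun (y : Fin (2 ^ (b + q)) → ℝ) v => (P v).eval y) := by
  have h4 := four_mul_two_pow b q
  have hpos : 0 < 2 ^ (b + q) := by positivity
  -- A missing operand is read from the first slot of the padding, which contains `0`.
  let slot : Option (Fin (2 ^ (b + q))) → Fin (2 ^ (b + 2 + q)) := fun o =>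
    ⟨o.elim (2 ^ (b + q)) fun v => (v : ℕ), by
      cases o with
      | none => simp only [Option.elim]; omega
      | some v => have := v.2; simp only [Option.elim]; omega⟩
  have hslot : ∀ y o, padSlots y (slot o) = readSlot y o := by
    intro y o
    cases o with
    | none => simp [padSlots, slot, readSlot]
    | some v => simp [padSlots, slot, readSlot]
  let f : Fin (2 ^ (b + 2 + q)) → Fin (2 ^ (b + 2 + q)) := fun v =>
    let i : Fin (2 ^ (b + q)) := ⟨v % 2 ^ (b + q), Nat.mod_lt _ hpos⟩
    if (v : ℕ) / 2 ^ (b + q) = 0 then slot (P i).y else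
      if (v : ℕ) / 2 ^ (b + q) = 1 then slot (P i).z else slot (P i).t
  have hf : ∀ (k : ℕ) (v : Fin (2 ^ (b + q))) (h : (v : ℕ) + k * 2 ^ (b + q) < 2 ^ (b + 2 + q)),
      f ⟨v + k * 2 ^ (b + q), h⟩ =
        if k = 0 then slot (P v).y else if k = 1 then slot (P v).z else slot (P v).t := by
    intro k v h
    simp only [f, Nat.add_mul_mod_self_right, Nat.mod_eq_of_lt v.2, Nat.add_mul_div_right _ _ hpos,
      Nat.div_eq_of_lt v.2, zero_add]
  have hroute := (Routable.all f).simulates hd hq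
  have hgate := simulates_gate hd P (fun x v => x (⟨v, by have := v.2; omega⟩))
    (fun x v => x ⟨v + 2 ^ (b + q), by have := v.2; omega⟩)
    (fun x v => x ⟨v + 3 * 2 ^ (b + q), by have := v.2; omega⟩)
    (fun _ _ => rfl) (fun _ _ => rfl) (fun _ _ => rfl)
  obtain ⟨ls, h1, h2, h3⟩ := hroute.comp hgate
  refine ⟨ls, h1, h2, fun y => ?_⟩
  have h := h3 (padSlots y)
  simp only [slotFun_padSlots] at h
  rw [h]
  congr 2
  funext v
  have e0 := hf 0 v (by have := v.2; omega)
  have e1 := hf 1 v (by have := v.2; omega)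
  have e3 := hf 3 v (by have := v.2; omega)
  simp only [zero_mul, add_zero, one_mul] at e0 e1 e3
  simp [e0, e1, e3, hslot, Instr.eval]

/-- The contents of a matrix, extended by zeros. -/
def zeroExtend {n d : ℕ} (u : Matrix (Fin n) (Fin d) ℝ) (i c : ℕ) : ℝ :=
  if h : i < n ∧ c < d then u ⟨i, h.1⟩ ⟨c, h.2⟩ else 0

/-- The slot that holds an entry of an input or output matrix with `n` rows. -/
def entrySlot {b q n d : ℕ} (hd : d ≤ 2 ^ (q + 1)) (hn : 2 * n ≤ 2 ^ b) (i : Fin n) (c : Fin d) :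
    Fin (2 ^ (b + q)) :=
  if h : (c : ℕ) < 2 ^ q then
    ⟨(i + n) * 2 ^ q + c, mul_two_pow_add_lt (by have := i.2; omega) h⟩
  else ⟨i * 2 ^ q + (c - 2 ^ q), mul_two_pow_add_lt (by have := i.2; omega)
    (by have := c.2; rw [pow_succ] at hd; omega)⟩

theorem readSlots_entrySlot {n : ℕ} (hd : d ≤ 2 ^ (q + 1)) (hn : 2 * n ≤ 2 ^ b) (i : Fin n)
    (c : Fin d) (y : Fin (2 ^ (b + q)) → ℝ) : y (entrySlot hd hn i c) =
      if (c : ℕ) < 2 ^ q then slotFun y (i + n) c else slotFun y i (c - 2 ^ q) := by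
  have hi := i.2
  have hc := c.2
  have hd' := hd
  rw [pow_succ] at hd'
  unfold entrySlot
  split_ifs with h
  · rw [slotFun_of_lt _ (by omega) h]
  · rw [slotFun_of_lt _ (by omega) (by omega)]

/-- The input may have almost `2 ^ (q + 1)` columns, the memory only `2 ^ q`. Inverting column bit
`q` brings the right part over the left one in rows `0` to `n - 1`, while the left part is shifted
down by `n` rows. -/
theorem simulates_gather {n : ℕ} (hd : d ≤ 2 ^ (q + 1)) (hn : 2 * n ≤ 2 ^ b) :
    ∃ G : Matrix (Fin n) (Fin d) ℝ → Fin (2 ^ (b + q)) → ℝ,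
      Simulates q (N := 8 * 2 ^ (b + 2)) (d := d) 2 (fun u => matOf (zeroExtend u))
        (fun y => matOf (slotFun y)) G ∧ ∀ u i c, G u (entrySlot hd hn i c) = u i c := by
  have h4 : 2 ^ (b + 2) = 4 * 2 ^ b := by rw [pow_add]; ring
  have hqpos : 0 < 2 ^ q := by positivity
  have hd' := hd
  rw [pow_succ] at hd'
  let g : Matrix (Fin n) (Fin d) ℝ → ℕ → ℕ → ℝ := fun u i c =>
    if i < n then zeroExtend u i (c + 2 ^ q) else zeroExtend u (i - n) c
  let G : Matrix (Fin n) (Fin d) ℝ → Fin (2 ^ (b + q)) → ℝ := fun u v =>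
    g u (v / 2 ^ q) (v % 2 ^ q)
  have hG : ∀ u i c, i < 2 ^ b → c < 2 ^ q → slotFun (G u) i c = g u i c := by
    intro u i c hi hc
    rw [slotFun_of_lt _ hi hc]
    simp only [G]
    rw [mul_comm i, Nat.mul_add_div hqpos, Nat.mul_add_mod, Nat.div_eq_of_lt hc,
      Nat.mod_eq_of_lt hc, add_zero]
  refine ⟨G, ?_, fun u i c => ?_⟩
  · refine simulates_shifts hd (s := n) (by omega) ⟨q, by omega⟩ 0 1
      (fun i c => if i < n ∧ c < 2 ^ q then 1 else 0)
      (fun i c => if i < n ∧ c < 2 ^ q then 1 else 0) 0 _ _ _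
      (fun u i c h => dif_neg (by omega)) ?_
    intro u i c hi hc
    simp only [Pi.zero_apply, zero_mul, add_zero, zero_add, one_mul]
    by_cases hc' : c < 2 ^ q
    swap
    · rw [slotFun_eq_zero _ (Or.inr (not_lt.1 hc'))]
      simp [hc']
    by_cases hi' : i < 2 ^ b
    · rw [hG u i c hi' hc', if_pos (by omega)]
      by_cases h : i < n
      · simp [g, h, hc', xor_two_pow_of_lt hc', not_le.2 h]
      · have h' : n ≤ i := not_lt.1 h
        simp only [g, if_neg h, h, if_false, zero_mul, zero_add, if_pos h', hc',
          and_true]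
        split_ifs with h2
        · rw [one_mul]
        · rw [zero_mul]
          exact dif_neg (by omega)
    · rw [slotFun_eq_zero _ (Or.inl (not_lt.1 hi')), if_neg (by omega : ¬ (i < n ∧ c < 2 ^ q)),
        if_neg (by omega : ¬ (i - n < n ∧ c < 2 ^ q))]
      simp
  · rw [readSlots_entrySlot hd hn i c (G u)]
    have hi := i.2
    have hc := c.2
    split_ifs with h
    · rw [hG _ _ _ (by omega) h]
      simp [g, zeroExtend]
    · rw [hG _ _ _ (by omega) (by omega)]
      simp [g, zeroExtend, Nat.sub_add_cancel (not_lt.1 h)]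

/-- Gathering keeps all entries of an arbitrary matrix, so an indicator matrix separates the slots.
-/
theorem entrySlot_injective {n : ℕ} (hd : d ≤ 2 ^ (q + 1)) (hn : 2 * n ≤ 2 ^ b)
    {i i' : Fin n} {c c' : Fin d} (h : entrySlot hd hn i c = entrySlot hd hn i' c') :
    i = i' ∧ c = c' := by
  obtain ⟨G, -, hG⟩ := simulates_gather (n := n) hd hn
  have h1 := hG (Matrix.of fun j e => if j = i ∧ e = c then 1 else 0) i c
  rw [h, hG] at h1
  simp only [Matrix.of_apply, and_self, if_true] at h1
  by_contra h2
  rw [if_neg (fun e => h2 ⟨e.1.symm, e.2.symm⟩)] at h1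
  exact zero_ne_one h1

/-- The inverse of the gathering move: bit `q` of the column is inverted for the right part, and the
left part is shifted up by `n` rows. -/
theorem simulates_scatter {n : ℕ} (hd : d ≤ 2 ^ (q + 1)) (hq : 2 ^ q ≤ d) (hn : 2 * n ≤ 2 ^ b) :
    Simulates q (N := 8 * 2 ^ (b + 2)) (d := d) 2 (fun y => matOf (slotFun y))
      (fun u => matOf (zeroExtend u))
      (fun y => Matrix.of fun i c => y (entrySlot hd hn i c)) := by
  have h4 : 2 ^ (b + 2) = 4 * 2 ^ b := by rw [pow_add]; ring
  have hd' := hd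
  rw [pow_succ] at hd'
  refine simulates_shifts hd (s := n) (by omega) ⟨q, by omega⟩ 0 1
    (fun i c => if i < n ∧ 2 ^ q ≤ c then 1 else 0) 0
    (fun i c => if i < 2 * n ∧ c < 2 ^ q then 1 else 0) _ _ _
    (fun y i c h => slotFun_eq_zero y (by omega)) ?_
  intro y i c _ hc
  by_cases hi : i < n
  · rw [zeroExtend, dif_pos ⟨hi, hc⟩, Matrix.of_apply, readSlots_entrySlot hd hn _ _ y,
      if_pos (by omega : i < 2 ^ (b + 2))]
    by_cases hc' : c < 2 ^ q
    · have : i + n < 2 * n := by omega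
      simp [hc', this, not_le.2 hc']
    · obtain ⟨e, rfl⟩ := Nat.exists_eq_add_of_le (not_lt.1 hc')
      have he : (2 ^ q + e) ^^^ 2 ^ q = e := by
        rw [add_comm, ← xor_two_pow_of_lt (by omega), Nat.xor_assoc, Nat.xor_self, Nat.xor_zero]
      simp [hi, he]
  · rw [zeroExtend, dif_neg (by omega)]
    have : ¬ i + n < 2 * n := by omega
    simp [hi, this]

end Machine

/-! ### Compiling circuits into programs. -/

/-- Application of the instructions of all slots to a vector. -/
def instrStep {K : ℕ} (P : Fin K → Instr K) (y : Fin K → ℝ) (v : Fin K) : ℝ := (P v).eval y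

/-- Execution of a program. -/
def runProgram {K : ℕ} (ps : List (Fin K → Instr K)) (y : Fin K → ℝ) : Fin K → ℝ :=
  ps.foldl (fun y P => instrStep P y) y

/-- The sum of an optional slot and a constant. -/
def Instr.copy {K : ℕ} (o : Option (Fin K)) (c : ℝ) : Instr K := ⟨none, none, o, 0, 0, c⟩

theorem Instr.copy_eval {K : ℕ} (o : Option (Fin K)) (c : ℝ) (x : Fin K → ℝ) :
    (Instr.copy o c).eval x = readSlot x o + c := by
  simp [Instr.copy, Instr.eval, readSlot]

theorem simulates_runProgram {b q d : ℕ} (hd : d ≤ 2 ^ (q + 1)) (hq : 2 ^ q ≤ d)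
    (ps : List (Fin (2 ^ (b + q)) → Instr (2 ^ (b + q)))) :
    Simulates q (N := 8 * 2 ^ (b + 2)) (d := d) (ps.length * (2 * (5 * (b + 2 + q)) + 2))
      (fun y => matOf (slotFun y)) (fun y => matOf (slotFun y)) (runProgram ps) := by
  induction ps with
  | nil =>
    rw [List.length_nil, zero_mul]
    exact Simulates.id _
  | cons P ps ih =>
    have := (simulates_step hd hq P).comp ih
    rw [List.length_cons, Nat.add_mul, Nat.one_mul, Nat.add_comm (ps.length * _)]
    exact this

theorem exists_instrs {ι : Type*} {K : ℕ} (S : Set ι) (loc : ι → Fin K) (hloc : S.InjOn loc)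
    (φ : ι → Instr K) : ∃ P : Fin K → Instr K, (∀ v ∈ S, P (loc v) = φ v) ∧
      ∀ s, (∀ v ∈ S, loc v ≠ s) → P s = Instr.copy none 0 := by
  classical
  refine ⟨fun s => if h : ∃ v ∈ S, loc v = s then φ h.choose else Instr.copy none 0, ?_, ?_⟩
  · intro v hv
    have h : ∃ v' ∈ S, loc v' = loc v := ⟨v, hv, rfl⟩
    simp only [dif_pos h]
    rw [hloc h.choose_spec.1 hv h.choose_spec.2]
  · intro s hs
    refine dif_neg ?_
    rintro ⟨v, hv, e⟩
    exact hs v hv e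

theorem exists_injOn_of_ncard_le {ι : Type*} [Finite ι] {K : ℕ} (hK : 0 < K) (S : Set ι)
    (hS : S.ncard ≤ K) : ∃ loc : ι → Fin K, S.InjOn loc := by
  classical
  have := Fintype.ofFinite ι
  have hcard : Fintype.card S ≤ Fintype.card (Fin K) := by
    rwa [Fintype.card_fin, ← Nat.card_eq_fintype_card, Nat.card_coe_set_eq]
  obtain ⟨e⟩ := Function.Embedding.nonempty_of_card_le hcard
  refine ⟨fun v => if h : v ∈ S then e ⟨v, h⟩ else ⟨0, hK⟩, fun u hu v hv h => ?_⟩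
  simp only [dif_pos hu, dif_pos hv] at h
  exact congrArg Subtype.val (e.injective h)

namespace ArithCircuit

variable {m k : ℕ} (C : ArithCircuit m k)

/-- The node is not labelled by a constant. -/
def NonConst (v : Fin C.size) : Prop := ∀ c, C.node v ≠ .const c

/-- The slot to read for a node: none for a constant. -/
def opSlot {K : ℕ} (loc : Fin C.size → Fin K) (v : Fin C.size) : Option (Fin K) :=
  match C.node v with
  | .const _ => none
  | _ => some (loc v)

/-- The constant to add for a node: zero unless it is labelled by a constant. -/
def opConst (v : Fin C.size) : ℝ :=
  match C.node v with
  | .const c => c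
  | _ => 0

theorem readSlot_opSlot {K : ℕ} (loc : Fin C.size → Fin K) (v : Fin C.size) (x : Fin m → ℝ)
    (y : Fin K → ℝ) (h : C.NonConst v → y (loc v) = C.value x v) :
    readSlot y (C.opSlot loc v) + C.opConst v = C.value x v := by
  by_cases hc : C.NonConst v
  · rw [← h hc]
    unfold opSlot opConst
    cases hv : C.node v with
    | const c => exact absurd hv (hc c)
    | var a => simp [readSlot]
    | add a b => simp [readSlot]
    | mul a b => simp [readSlot]
  · obtain ⟨c, hc⟩ : ∃ c, C.node v = .const c := by simpa [NonConst] using hc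
    rw [value]
    unfold opSlot opConst
    simp [hc, readSlot]

/-- The instruction for a gate whose operands are in the given slots. -/
def gateInstr {K : ℕ} (loc : Fin C.size → Fin K) (v : Fin C.size) : Instr K :=
  match C.node v with
  | .add a b => ⟨C.opSlot loc ⟨a, a.2.trans v.2⟩, none, C.opSlot loc ⟨b, b.2.trans v.2⟩,
      C.opConst ⟨a, a.2.trans v.2⟩, 1, C.opConst ⟨b, b.2.trans v.2⟩⟩
  | .mul a b => ⟨C.opSlot loc ⟨a, a.2.trans v.2⟩, C.opSlot loc ⟨b, b.2.trans v.2⟩, none,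
      C.opConst ⟨a, a.2.trans v.2⟩, C.opConst ⟨b, b.2.trans v.2⟩, 0⟩
  | _ => Instr.copy (C.opSlot loc v) (C.opConst v)

theorem gateInstr_eval {K : ℕ} (loc : Fin C.size → Fin K) (v : Fin C.size) (x : Fin m → ℝ)
    (y : Fin K → ℝ) (hv : ∀ z, C.node v ≠ .var z)
    (h : ∀ a, C.Wire a v → C.NonConst a → y (loc a) = C.value x a) :
    (C.gateInstr loc v).eval y = C.value x v := by
  have hop : ∀ a, C.Wire a v → readSlot y (C.opSlot loc a) + C.opConst a = C.value x a :=
    fun a ha => C.readSlot_opSlot loc a x y (h a ha)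
  unfold gateInstr
  cases hn : C.node v with
  | var z => exact absurd hn (hv z)
  | const c =>
    simp only [Instr.copy_eval]
    exact C.readSlot_opSlot loc v x y fun h => absurd hn (h c)
  | add a b =>
    have ha : C.Wire ⟨a, a.2.trans v.2⟩ v := by simp [Wire, hn, CircuitNode.HasOperand]
    have hb : C.Wire ⟨b, b.2.trans v.2⟩ v := by simp [Wire, hn, CircuitNode.HasOperand]
    rw [value]
    simp only [hn, Instr.eval, hop _ ha, hop _ hb]
    simp [readSlot]
  | mul a b =>
    have ha : C.Wire ⟨a, a.2.trans v.2⟩ v := by simp [Wire, hn, CircuitNode.HasOperand]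
    have hb : C.Wire ⟨b, b.2.trans v.2⟩ v := by simp [Wire, hn, CircuitNode.HasOperand]
    rw [value]
    simp only [hn, Instr.eval, hop _ ha, hop _ hb]
    simp [readSlot]

variable {C}

/-- The signals to be kept after level `l`: those of the cut, and the outputs computed so far. -/
def Drawing.live (D : C.Drawing) (l : ℕ) : Set (Fin C.size) :=
  {v | C.NonConst v ∧ (D.level v = l ∨ D.level v < l ∧
    ((∃ i, C.Wire v i ∧ l < D.level i) ∨ ∃ j, C.out j = v))}

theorem Drawing.ncard_live_le (D : C.Drawing) (l : ℕ) :
    (D.live l).ncard ≤ (D.cut l).ncard + k := by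
  have hsub : D.live l ⊆ D.cut l ∪ Set.range C.out := by
    rintro v ⟨hc, h | ⟨h, h' | ⟨j, rfl⟩⟩⟩
    · exact Or.inl ⟨hc, Or.inl h⟩
    · exact Or.inl ⟨hc, Or.inr ⟨h, h'⟩⟩
    · exact Or.inr ⟨j, rfl⟩
  have hk : (Set.range C.out).ncard ≤ k := by
    rw [← Set.image_univ]
    refine (Set.ncard_image_le).trans ?_
    simp [Set.ncard_univ]
  calc (D.live l).ncard ≤ (D.cut l ∪ Set.range C.out).ncard := Set.ncard_le_ncard hsub
    _ ≤ (D.cut l).ncard + (Set.range C.out).ncard := Set.ncard_union_le _ _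
    _ ≤ _ := Nat.add_le_add_left hk _

theorem Drawing.exists_var_of_level_eq_zero (D : C.Drawing) {v : Fin C.size} (hc : C.NonConst v)
    (hv : D.level v = 0) : ∃ z, C.node v = .var z := by
  have hw : ∀ a, ¬ C.Wire a v := fun a h => by
    have := D.level_lt _ _ h
    omega
  cases hn : C.node v with
  | var z => exact ⟨z, rfl⟩
  | const c => exact absurd hn (hc c)
  | add a b => exact absurd (by simp [Wire, hn, CircuitNode.HasOperand]) (hw ⟨a, a.2.trans v.2⟩)
  | mul a b => exact absurd (by simp [Wire, hn, CircuitNode.HasOperand]) (hw ⟨a, a.2.trans v.2⟩)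

theorem Drawing.mem_live_of_mem_live_succ (D : C.Drawing) {l : ℕ} {v : Fin C.size}
    (hv : v ∈ D.live (l + 1)) (h : D.level v ≠ l + 1) : v ∈ D.live l := by
  obtain ⟨hc, h1 | ⟨h1, h2⟩⟩ := hv
  · exact absurd h1 h
  · refine ⟨hc, ?_⟩
    rcases (Nat.lt_succ_iff.1 h1).eq_or_lt with e | e
    · exact Or.inl e
    · refine Or.inr ⟨e, h2.imp_left ?_⟩
      rintro ⟨i, hi, hl⟩
      exact ⟨i, hi, by omega⟩

theorem Drawing.mem_live_of_wire (D : C.Drawing) {l : ℕ} {a v : Fin C.size}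
    (hv : D.level v = l + 1) (ha : C.Wire a v) (hc : C.NonConst a) : a ∈ D.live l := by
  have h := D.level_lt _ _ ha
  refine ⟨hc, ?_⟩
  rcases (show D.level a ≤ l by omega).eq_or_lt with e | e
  · exact Or.inl e
  · exact Or.inr ⟨e, Or.inl ⟨v, ha, by omega⟩⟩

/-- The placement `loc` is chosen afresh at each level, which costs nothing since a step can read
any slots. Constants occupy no slot; they enter through the biases of the instructions. -/
theorem Drawing.exists_program_live (D : C.Drawing) {K : ℕ} (hK : 0 < K)
    (hD : ∀ l, (D.cut l).ncard + k ≤ K) (inp : Fin m → Fin K) (l : ℕ) :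
    ∃ ps : List (Fin K → Instr K), ps.length = l + 1 ∧ ∃ loc : Fin C.size → Fin K,
      ∀ (x : Fin m → ℝ) (y : Fin K → ℝ), (∀ z, y (inp z) = x z) →
        ∀ v ∈ D.live l, runProgram ps y (loc v) = C.value x v := by
  classical
  induction l with
  | zero =>
    obtain ⟨loc, hloc⟩ := exists_injOn_of_ncard_le hK (D.live 0)
      ((D.ncard_live_le 0).trans (hD 0))
    obtain ⟨P, hP, -⟩ := exists_instrs _ loc hloc fun v =>
      Instr.copy (match C.node v with | .var z => some (inp z) | _ => none) 0
    refine ⟨[P], rfl, loc, fun x y hy v hv => ?_⟩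
    have hl : D.level v = 0 := by
      rcases hv.2 with h | h <;> omega
    obtain ⟨z, hz⟩ := D.exists_var_of_level_eq_zero hv.1 hl
    change (P (loc v)).eval y = _
    rw [hP v hv, Instr.copy_eval, value]
    simp [hz, readSlot, hy]
  | succ l ih =>
    obtain ⟨ps, hlen, loc, hps⟩ := ih
    obtain ⟨loc', hloc'⟩ := exists_injOn_of_ncard_le hK (D.live (l + 1))
      ((D.ncard_live_le _).trans (hD _))
    -- Nodes on the new level are computed, their operands being live before; every other live node
    -- was live before and is copied.
    obtain ⟨P, hP, -⟩ := exists_instrs _ loc' hloc' fun v =>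
      if D.level v = l + 1 then C.gateInstr loc v else Instr.copy (C.opSlot loc v) (C.opConst v)
    refine ⟨ps ++ [P], by simp [hlen], loc', fun x y hy v hv => ?_⟩
    have hrun : runProgram (ps ++ [P]) y (loc' v) = (P (loc' v)).eval (runProgram ps y) := by
      simp [runProgram, instrStep]
    rw [hrun, hP v hv]
    split_ifs with h
    · refine C.gateInstr_eval loc v x _ (fun z hz => ?_) fun a ha hc =>
        hps x y hy a (D.mem_live_of_wire h ha hc)
      have := D.level_var _ _ hz
      omega
    · rw [Instr.copy_eval]
      exact C.readSlot_opSlot loc v x _ fun _ =>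
        hps x y hy v (D.mem_live_of_mem_live_succ hv h)

/-- Levels `0` to `Δ` take `Δ + 1` steps; one more moves the outputs to their final slots and clears
all others. -/
theorem Drawing.exists_program (D : C.Drawing) {K Δ : ℕ} (hK : 0 < K)
    (hD : ∀ l, (D.cut l).ncard + k ≤ K) (hΔ : ∀ j, D.level (C.out j) ≤ Δ) (inp : Fin m → Fin K)
    (out : Fin k → Fin K) (hout : Function.Injective out) :
    ∃ ps : List (Fin K → Instr K), ps.length = Δ + 2 ∧
      ∀ (x : Fin m → ℝ) (y : Fin K → ℝ), (∀ z, y (inp z) = x z) →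
        (∀ j, runProgram ps y (out j) = C.value x (C.out j)) ∧
        ∀ s, (∀ j, out j ≠ s) → runProgram ps y s = 0 := by
  obtain ⟨ps, hlen, loc, hps⟩ := D.exists_program_live hK hD inp Δ
  obtain ⟨P, hP, hP0⟩ := exists_instrs Set.univ out hout.injOn fun j =>
    Instr.copy (C.opSlot loc (C.out j)) (C.opConst (C.out j))
  have hrun : ∀ y s, runProgram (ps ++ [P]) y s = (P s).eval (runProgram ps y) := fun y s => by
    simp [runProgram, instrStep]
  refine ⟨ps ++ [P], by simp [hlen], fun x y hy => ⟨fun j => ?_, fun s hs => ?_⟩⟩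
  · rw [hrun, hP j trivial, Instr.copy_eval]
    refine C.readSlot_opSlot loc _ x _ fun hc => hps x y hy _ ⟨hc, ?_⟩
    exact (hΔ j).eq_or_lt.imp_right fun h => ⟨h, Or.inr ⟨j, rfl⟩⟩
  · rw [hrun, hP0 s fun j _ => hs j, Instr.copy_eval]
    simp [readSlot]

end ArithCircuit

/-! ### The model and its resource bounds. -/

theorem Simulates.exists_model {q n d N L : ℕ} (hN : n ≤ N)
    {T : Matrix (Fin n) (Fin d) ℝ → Matrix (Fin n) (Fin d) ℝ}
    (h : Simulates q (N := N) (d := d) L (fun u => matOf (zeroExtend u))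
      (fun u => matOf (zeroExtend u)) T) :
    ∃ M : BaseConvModel n L d N d, (∀ u, M.eval u = T u) ∧
      ∀ i, (M.layer i).weight.width = 1 ∧ (M.layer i).weight.logSize = q + 1 := by
  obtain ⟨ls, rfl, h2, h3⟩ := h
  refine ⟨⟨hN, le_rfl, ls.get⟩, fun u => ?_, fun i => h2 _ (List.get_mem ls i)⟩
  have h := h3 u
  simp only [BaseConvModel.eval, List.ofFn_get]
  have he : (BaseConvModel.embed N d u) = matOf (zeroExtend u) := rfl
  rw [he, h]
  ext i c
  simp [matOf, zeroExtend]

/-- All variables lie on level `0`, so the width bounds the size of the input and thereby the number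
of outputs. -/
theorem ArithCircuit.Drawing.card_vars_le {m k : ℕ} {C : ArithCircuit m k} (D : C.Drawing) :
    m ≤ (D.cut 0).ncard := by
  choose f hf using C.var_node
  have hinj : Function.Injective f := fun a b h => by
    have := hf a
    rw [h, hf b] at this
    injection this with h
    exact h.symm
  have hsub : Set.range f ⊆ D.cut 0 := by
    rintro _ ⟨a, rfl⟩
    refine ⟨fun c h => ?_, Or.inl (D.level_var _ _ (hf a))⟩
    rw [hf a] at h
    cases h
  calc m = (Set.range f).ncard := by
        rw [← Set.image_univ, Set.ncard_image_of_injective _ hinj]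
        simp [Set.ncard_univ]
    _ ≤ _ := Set.ncard_le_ncard hsub

theorem simulates_circuit {b q n d k Δ : ℕ} (hd : d ≤ 2 ^ (q + 1)) (hq : 2 ^ q ≤ d)
    (hn : 2 * n ≤ 2 ^ b) (hk : k ≤ n * d) (C : ArithCircuit (n * d) k) (D : C.Drawing)
    (hD : ∀ l, (D.cut l).ncard + k ≤ 2 ^ (b + q)) (hΔ : ∀ j, D.level (C.out j) ≤ Δ) :
    Simulates q (N := 8 * 2 ^ (b + 2)) (d := d)
      (2 + (Δ + 2) * (2 * (5 * (b + 2 + q)) + 2) + 2)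
      (fun u : Matrix (Fin n) (Fin d) ℝ => matOf (zeroExtend u)) (fun u => matOf (zeroExtend u))
      (fun u => ofRowMajor n d fun j => C.value (rowMajor u) (C.out j)) := by
  obtain ⟨G, hG, hGu⟩ := simulates_gather (n := n) hd hn
  let slot : Fin (n * d) → Fin (2 ^ (b + q)) := fun z => entrySlot hd hn z.divNat z.modNat
  have hslot : Function.Injective slot := by
    intro z z' h
    obtain ⟨h1, h2⟩ := entrySlot_injective hd hn h
    have e1 := congrArg Fin.val h1
    have e2 := congrArg Fin.val h2
    simp only [Fin.coe_divNat, Fin.coe_modNat] at e1 e2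
    apply Fin.ext
    rw [← Nat.div_add_mod (z : ℕ) d, e1, e2, Nat.div_add_mod]
  obtain ⟨ps, hlen, hps⟩ := D.exists_program (by positivity) hD hΔ slot
    (slot ∘ Fin.castLE hk) (hslot.comp (Fin.castLE_injective hk))
  have h := (hG.comp (simulates_runProgram hd hq ps)).comp (simulates_scatter hd hq hn)
  rw [hlen] at h
  convert h using 1
  funext u
  obtain ⟨h1, h2⟩ := hps (rowMajor u) (G u) fun z => hGu u _ _
  ext i c
  simp only [ofRowMajor, Matrix.of_apply, Function.comp_apply]
  have hdpos : 0 < d := c.pos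
  have hdiv : ((i : ℕ) * d + c) / d = i := by
    rw [mul_comm, Nat.mul_add_div hdpos, Nat.div_eq_of_lt c.2, add_zero]
  have hmod : ((i : ℕ) * d + c) % d = c := by
    rw [mul_comm, Nat.mul_add_mod, Nat.mod_eq_of_lt c.2]
  split_ifs with hic
  · rw [← h1]
    congr 1
    simp only [Function.comp_apply, slot]
    congr 1
    · exact Fin.ext (by simpa using hdiv)
    · exact Fin.ext (by simpa using hmod)
  · symm
    apply h2
    intro j hj
    obtain ⟨e1, e2⟩ := entrySlot_injective hd hn hj
    apply hic
    have e1' : (j : ℕ) / d = i := by simpa using congrArg Fin.val e1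
    have e2' : (j : ℕ) % d = c := by simpa using congrArg Fin.val e2
    rw [← e1', ← e2', mul_comm, Nat.div_add_mod]
    exact j.2

theorem BaseConvLayer.params_eq {q N d : ℕ} (ℓ : BaseConvLayer N d) (h1 : ℓ.weight.width = 1)
    (h2 : ℓ.weight.logSize = q + 1) :
    ℓ.params = 8 * ((q + 1) * 2 ^ q) + 3 * (N * d) := by
  rw [BaseConvLayer.params, Kaleidoscope.params, h1, h2, pow_succ]
  ring

theorem layer_count_le {M Δ : ℕ} {lam : ℝ} (hM : (M : ℝ) ≤ 5 * lam) (hlam : 1 ≤ 3 / 2 * lam)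
    (hΔ : 1 ≤ Δ) : ((2 + (Δ + 2) * (2 * (5 * (M + 2)) + 2) + 2 : ℕ) : ℝ) ≤ 255 * (Δ * lam) := by
  have hΔ' : (1 : ℝ) ≤ Δ := by exact_mod_cast hΔ
  push_cast
  have h1 : (2 * (5 * ((M : ℝ) + 2)) + 2) ≤ 83 * lam := by linarith
  have h2 : ((Δ : ℝ) + 2) * (2 * (5 * ((M : ℝ) + 2)) + 2) ≤ 3 * Δ * (83 * lam) :=
    mul_le_mul (by linarith) h1 (by positivity) (by positivity)
  have h3 : lam ≤ Δ * lam := le_mul_of_one_le_left (by linarith) hΔ'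
  nlinarith

theorem layer_params_le {q N d W : ℕ} {lam : ℝ} (hq : (q : ℝ) ≤ 5 * lam) (hlam : 1 ≤ 3 / 2 * lam)
    (hqW : 2 ^ q ≤ W) (hN : N * d ≤ 256 * W) :
    ((8 * ((q + 1) * 2 ^ q) + 3 * (N * d) : ℕ) : ℝ) ≤ 1204 * (W * lam) := by
  have hqW' : (2 : ℝ) ^ q ≤ W := by exact_mod_cast hqW
  have hN' : (N : ℝ) * d ≤ 256 * W := by exact_mod_cast hN
  have hW : (0 : ℝ) ≤ W := Nat.cast_nonneg _
  push_cast
  have h1 : ((q : ℝ) + 1) * 2 ^ q ≤ (13 / 2 * lam) * W :=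
    mul_le_mul (by linarith) hqW' (by positivity) (by linarith)
  have h2 : (W : ℝ) ≤ W * (3 / 2 * lam) := le_mul_of_one_le_right hW hlam
  nlinarith

theorem theorem3p1 :
    ∃ (A : ℝ) (c : ℕ), ∀ (n d k s Δ w : ℕ), 1 ≤ n → 1 ≤ d → k ≤ n * d →
      2 ≤ s → 1 ≤ Δ → 2 ≤ w →
      ∀ C : ArithCircuit (n * d) k, C.HasBounds s Δ w →
        ∃ (L N' : ℕ) (M : BaseConvModel n L d N' d),
          (∀ u : Matrix (Fin n) (Fin d) ℝ,
            M.eval u = ofRowMajor n d fun j => C.value (rowMajor u) (C.out j)) ∧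
          (L : ℝ) ≤ A * (Δ * Real.log w) ∧
          ((N' * d : ℕ) : ℝ) ≤ A * w ∧
          (∀ i, (M.layer i).weight.IsPolylog A c) ∧
          (M.params : ℝ) ≤ A * (s * Δ * Real.log s ^ c) := by
  -- `400000` exceeds `255 * 1204`, the product of the constants for the number of layers and for
  -- the parameters of a layer. Each of these two bounds contributes one logarithm, hence the
  -- exponent `2`.
  refine ⟨400000, 2, fun n d k s Δ w hn hd hk hs hΔ hw C hC => ?_⟩
  obtain ⟨D, hDout, hDw⟩ := hC.width_le
  -- A cut has no more signals than the circuit has nodes. Working with the minimum gives bounds in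
  -- terms of `w` and of `s` at once.
  let W := min w s
  have hWs : W ≤ s := min_le_right _ _
  have hWw : W ≤ w := min_le_left _ _
  have hW2 : 2 ≤ W := le_min hw hs
  have hcut : ∀ l, (D.cut l).ncard ≤ W := fun l => le_min (hDw l) <| by
    have h := Set.ncard_le_card (D.cut l)
    rw [Nat.card_eq_fintype_card, Fintype.card_fin] at h
    exact h.trans hC.size_le
  have hnd : n * d ≤ W := D.card_vars_le.trans (hcut 0)
  have hdW : d ≤ W := (Nat.le_mul_of_pos_left d hn).trans hnd
  obtain ⟨q, hq⟩ : ∃ q, q = Nat.log 2 d := ⟨_, rfl⟩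
  have hqd : 2 ^ q ≤ d := hq ▸ Nat.pow_log_le_self 2 (by omega)
  have hdq : d ≤ 2 ^ (q + 1) := hq ▸ (Nat.lt_pow_succ_log_self one_lt_two d).le
  -- The memory has `2 ^ m ≥ 2 W` slots: `W` for a cut and `W` for the outputs.
  obtain ⟨m, hm⟩ : ∃ m, m = Nat.clog 2 (2 * W) := ⟨_, rfl⟩
  have hWm : 2 * W ≤ 2 ^ m := hm ▸ Nat.le_pow_clog one_lt_two _
  have hmW : 2 ^ m ≤ 4 * W := by
    have h1 := Nat.pow_pred_clog_lt_self one_lt_two (show 1 < 2 * W by omega)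
    have h2 : 0 < Nat.clog 2 (2 * W) := Nat.clog_pos one_lt_two (by omega)
    rw [← hm] at h1 h2
    obtain ⟨m', rfl⟩ := Nat.exists_eq_add_of_lt h2
    simp only [zero_add, Nat.pred_eq_sub_one, Nat.add_sub_cancel] at h1 ⊢
    rw [pow_succ]
    omega
  have hqm : q ≤ m := (Nat.pow_le_pow_iff_right one_lt_two).1 (by omega)
  obtain ⟨b, rfl⟩ := Nat.exists_eq_add_of_le' hqm
  have hbq : 2 ^ (b + q) = 2 ^ b * 2 ^ q := pow_add _ _ _
  have h2n : 2 * n ≤ 2 ^ b := by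
    refine Nat.le_of_mul_le_mul_right (c := 2 ^ q) ?_ (by positivity)
    calc 2 * n * 2 ^ q ≤ 2 * n * d := Nat.mul_le_mul_left _ hqd
      _ = 2 * (n * d) := mul_assoc _ _ _
      _ ≤ 2 ^ b * 2 ^ q := by omega
  have hb4 : 2 ^ (b + 2) = 4 * 2 ^ b := by rw [pow_add]; ring
  have hNd : 8 * 2 ^ (b + 2) * d ≤ 256 * W := by
    calc 8 * 2 ^ (b + 2) * d ≤ 8 * 2 ^ (b + 2) * 2 ^ (q + 1) := Nat.mul_le_mul_left _ hdq
      _ = 64 * (2 ^ (b + q)) := by rw [hb4, hbq, pow_succ]; ring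
      _ ≤ 256 * W := by omega
  obtain ⟨M, hM, hMw⟩ := (simulates_circuit hdq hqd h2n hk C D
    (fun l => by have := hcut l; omega) hDout).exists_model (by omega)
  set lam := Real.log W with hlam
  have hW0 : (0 : ℝ) < W := by exact_mod_cast (by omega : 0 < W)
  have hlam2 : Real.log 2 ≤ lam := Real.log_le_log two_pos (by exact_mod_cast hW2)
  have hlog2 := Real.log_two_gt_d9
  have hlam1 : 1 ≤ 3 / 2 * lam := by linarith
  have hlamw : lam ≤ Real.log w := Real.log_le_log hW0 (by exact_mod_cast hWw)
  have hlams : lam ≤ Real.log s := Real.log_le_log hW0 (by exact_mod_cast hWs)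
  -- From `2 ^ (b + q) ≤ 4 W` and `log 2 ≤ lam` one gets `(b + q) log 2 ≤ 3 lam`, and `3 / log 2 <
  -- 5`.
  have hmlam : ((b + q : ℕ) : ℝ) ≤ 5 * lam := by
    have h : Real.log ((2 : ℝ) ^ (b + q)) ≤ Real.log (2 ^ 2 * W) :=
      Real.log_le_log (by positivity) (by
        have : ((2 ^ (b + q) : ℕ) : ℝ) ≤ ((4 * W : ℕ) : ℝ) := Nat.cast_le.2 hmW
        push_cast at this
        linarith)
    rw [Real.log_mul (by positivity) hW0.ne', Real.log_pow, Real.log_pow] at h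
    have h0 : (0 : ℝ) ≤ (b + q : ℕ) := Nat.cast_nonneg _
    push_cast at h h0 ⊢
    nlinarith
  have hL : ((2 + (Δ + 2) * (2 * (5 * (b + 2 + q)) + 2) + 2 : ℕ) : ℝ) ≤ 255 * (Δ * lam) := by
    rw [add_right_comm b 2 q]
    exact layer_count_le hmlam hlam1 hΔ
  have hparams : ∀ i, ((M.layer i).params : ℝ) ≤ 1204 * (W * lam) := fun i => by
    rw [(M.layer i).params_eq (hMw i).1 (hMw i).2]
    refine layer_params_le (le_trans ?_ hmlam) hlam1 (hqd.trans hdW) hNd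
    exact_mod_cast Nat.le_add_left q b
  have hΔ0 : (0 : ℝ) ≤ Δ := Nat.cast_nonneg _
  have hlam0 : 0 ≤ lam := by linarith
  have hlogd : 1 ≤ (1 + Real.log d) ^ 2 :=
    one_le_pow₀ (by linarith [Real.log_natCast_nonneg d])
  refine ⟨_, _, M, hM, ?_, ?_, fun i => ⟨?_, ?_⟩, ?_⟩
  · have h1 : Δ * lam ≤ Δ * Real.log w := mul_le_mul_of_nonneg_left hlamw hΔ0
    have h2 : 0 ≤ Δ * lam := mul_nonneg hΔ0 hlam0
    linarith
  · have h1 : ((8 * 2 ^ (b + 2) * d : ℕ) : ℝ) ≤ ((256 * W : ℕ) : ℝ) := Nat.cast_le.2 hNd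
    have h2 : (W : ℝ) ≤ w := by exact_mod_cast hWw
    rw [Nat.cast_mul 256 W] at h1
    push_cast at h1 ⊢
    linarith
  · rw [(hMw i).1, Nat.cast_one]
    linarith
  · rw [(hMw i).2]
    have h1 : ((2 ^ (q + 1) : ℕ) : ℝ) ≤ ((2 * d : ℕ) : ℝ) := Nat.cast_le.2 (by
      rw [pow_succ]; omega)
    have h2 : (d : ℝ) ≤ (1 + Real.log d) ^ 2 * d :=
      le_mul_of_one_le_left (Nat.cast_nonneg _) hlogd
    rw [Nat.cast_mul 2 d] at h1
    have h3 : (0 : ℝ) ≤ d := Nat.cast_nonneg _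
    rw [mul_assoc]
    refine h1.trans ?_
    push_cast
    linarith
  · rw [BaseConvModel.params, Nat.cast_sum]
    have h1 := Finset.sum_le_card_nsmul Finset.univ (fun i => ((M.layer i).params : ℝ)) _
      fun i _ => hparams i
    rw [Finset.card_univ, Fintype.card_fin, nsmul_eq_mul] at h1
    refine h1.trans ((mul_le_mul_of_nonneg_right hL (by positivity)).trans ?_)
    have h2 : lam ^ 2 ≤ Real.log s ^ 2 := pow_le_pow_left₀ hlam0 hlams 2
    have h3 : (W : ℝ) ≤ s := by exact_mod_cast hWs
    have h4 : (W : ℝ) * Δ * lam ^ 2 ≤ s * Δ * Real.log s ^ 2 :=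
      mul_le_mul (mul_le_mul_of_nonneg_right h3 hΔ0) h2 (by positivity) (by positivity)
    have h5 : 0 ≤ (W : ℝ) * Δ * lam ^ 2 := by positivity
    nlinarith
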